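/- Let $\alpha>0$. For $0<p\le\infty$ let $F^p_\alpha$ be the Fock space of all entire functions $f:\mathbb C\to\mathbb C$ with $\|f\|_{p,\alpha}<\infty$, where $$\|f\|_{p,\alpha}=\Big(\frac{\alpha p}{2\pi}\int_{\mathbb C}\big|f(z)e^{-\frac{\alpha}{2}|z|^2}\big|^p\,dA(z)\Big)^{1/p}\quad(0<p<\infty),\qquad \|f\|_{\infty,\alpha}=\sup_{z\in\mathbb C}|f(z)|e^{-\frac{\alpha}{2}|z|^2},$$ and $dA$ is the area measure. $F^p_\alpha$ carries the metric $\|f-g\|_{p,\alpha}$ if $1\le p\le\infty$ and $\|f-g\|_{p,\alpha}^p$ if $0<p<1$. Let $\mu$ be a positive Borel measure on $(0,\infty)$ with $\int_0^\infty\frac{d\mu(t)}{t}=1$, and consider the Hausdorff operator $$\mathscr H_\mu(f)(z)=\int_0^\infty f\Big(\frac zt\Big)\,\frac{d\mu(t)}{t},\qquad z\in\mathbb C.$$ We say that $\mathscr H_\mu:F^p_\alpha\to F^q_\alpha$ is compact if it is well defined (for every $f\in F^p_\alpha$ the integral converges absolutely for every $z\in\mathbb C$, and $\mathscr H_\mu(f)\in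 F^q_\alpha$) and maps some neighbourhood of the origin of $F^p_\alpha$ to a relatively compact subset of $F^q_\alpha$. Then the following are equivalent: (i) there exist $0<p,q\le\infty$ such that $\mathscr H_\mu:F^p_\alpha\to F^q_\alpha$ is compact; (ii) $\mu((0,1])=0$; (iii) $\mathscr H_\mu:F^p_\alpha\to F^p_\alpha$ is compact for every $0<p\le\infty$. -/

import Mathlib

open MeasureTheory
open scoped ENNReal

noncomputable section

/-- The Fock (quasi-)norm of a function `f : ℂ → ℂ`, with values in `[0, ∞]`:
`(α p / (2π) ∫ |f(z) e^{-α|z|²/2}|^p dA(z))^{1/p}` for `0 < p < ∞` and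
`sup_z |f(z)| e^{-α|z|²/2}` for `p = ∞`. -/
def fockENorm (p : ℝ≥0∞) (α : ℝ) (f : ℂ → ℂ) : ℝ≥0∞ :=
  if p = ∞ then ⨆ z : ℂ, ‖f z‖ₑ * ENNReal.ofReal (Real.exp (-(α / 2) * ‖z‖ ^ 2))
  else (ENNReal.ofReal (α * p.toReal / (2 * Real.pi)) *
    ∫⁻ z : ℂ, (‖f z‖ₑ * ENNReal.ofReal (Real.exp (-(α / 2) * ‖z‖ ^ 2))) ^ p.toReal) ^
      (1 / p.toReal)

theorem fockENorm_zero (p : ℝ≥0∞) [hp : Fact (0 < p)] (α : ℝ) :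
    fockENorm p α (0 : ℂ → ℂ) = 0 := by
  unfold fockENorm
  split_ifs with h
  · simp
  · have : 0 < p.toReal := ENNReal.toReal_pos hp.out.ne' h
    simp [this]

theorem fockENorm_const_smul (p : ℝ≥0∞) [hp : Fact (0 < p)] (α : ℝ) (c : ℂ) (f : ℂ → ℂ) :
    fockENorm p α (c • f) = ‖c‖ₑ * fockENorm p α f := by
  unfold fockENorm
  split_ifs with h
  · simp only [Pi.smul_apply, enorm_smul, ENNReal.mul_iSup, mul_assoc]
  · have h0 : 0 < p.toReal := ENNReal.toReal_pos hp.out.ne' h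
    simp only [Pi.smul_apply, enorm_smul, mul_assoc]
    simp_rw [ENNReal.mul_rpow_of_nonneg ‖c‖ₑ _ h0.le]
    rw [lintegral_const_mul' _ _ (by simp [h0.le]), mul_left_comm,
      ENNReal.mul_rpow_of_nonneg _ _ (by positivity), ← ENNReal.rpow_mul,
      mul_one_div_cancel h0.ne', ENNReal.rpow_one]

theorem fockENorm_neg (p : ℝ≥0∞) (α : ℝ) (f : ℂ → ℂ) :
    fockENorm p α (-f) = fockENorm p α f := by
  simp [fockENorm]

theorem toReal_min_one_pos (p : ℝ≥0∞) [hp : Fact (0 < p)] : 0 < (min p 1).toReal :=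
  ENNReal.toReal_pos (lt_min hp.out one_pos).ne' (by simp)

/-- The triangle inequality for `‖·‖` (if `1 ≤ p`) or `‖·‖^p` (if `p < 1`). -/
theorem fockENorm_add_le (p : ℝ≥0∞) [hp : Fact (0 < p)] (α : ℝ) {f g : ℂ → ℂ}
    (hf : Continuous f) (hg : Continuous g) :
    fockENorm p α (f + g) ^ (min p 1).toReal ≤
      fockENorm p α f ^ (min p 1).toReal + fockENorm p α g ^ (min p 1).toReal := by
  set w : ℂ → ℝ≥0∞ := fun z => ENNReal.ofReal (Real.exp (-(α / 2) * ‖z‖ ^ 2)) with hw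
  have hwm : Measurable w := by fun_prop
  have hfm : Measurable fun z => ‖f z‖ₑ * w z := hf.measurable.enorm.mul hwm
  have hgm : Measurable fun z => ‖g z‖ₑ * w z := hg.measurable.enorm.mul hwm
  have key : ∀ z, ‖(f + g) z‖ₑ * w z ≤ ‖f z‖ₑ * w z + ‖g z‖ₑ * w z := fun z => by
    rw [← add_mul]; gcongr; exact enorm_add_le _ _
  by_cases h : p = ∞
  · subst h
    simp only [fockENorm, if_true, le_top, inf_of_le_right, ENNReal.toReal_one, ENNReal.rpow_one]
    exact iSup_le fun z => (key z).trans
      (add_le_add (le_iSup (fun z => ‖f z‖ₑ * w z) z) (le_iSup (fun z => ‖g z‖ₑ * w z) z))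
  have h0 : 0 < p.toReal := ENNReal.toReal_pos hp.out.ne' h
  simp only [fockENorm, if_neg h]
  set c := ENNReal.ofReal (α * p.toReal / (2 * Real.pi)) with hc
  have hmono : ∫⁻ z, (‖(f + g) z‖ₑ * w z) ^ p.toReal ≤
      ∫⁻ z, (‖f z‖ₑ * w z + ‖g z‖ₑ * w z) ^ p.toReal :=
    lintegral_mono fun z => ENNReal.rpow_le_rpow (key z) h0.le
  rcases le_total 1 p with h1 | h1
  · have h1' : 1 ≤ p.toReal := by
      rw [← ENNReal.toReal_one]; exact ENNReal.toReal_mono h h1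
    simp only [min_eq_right h1, ENNReal.toReal_one, ENNReal.rpow_one]
    have hn : 0 ≤ 1 / p.toReal := by positivity
    have := ENNReal.lintegral_Lp_add_le (μ := (volume : Measure ℂ)) hfm.aemeasurable
      hgm.aemeasurable h1'
    calc _ ≤ (c * ∫⁻ z, (‖f z‖ₑ * w z + ‖g z‖ₑ * w z) ^ p.toReal) ^ (1 / p.toReal) := by
          gcongr
      _ ≤ _ := by
          simp only [ENNReal.mul_rpow_of_nonneg _ _ hn]
          rw [← mul_add]
          gcongr
          exact this
  · simp only [min_eq_left h1, ← ENNReal.rpow_mul, one_div, inv_mul_cancel₀ h0.ne',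
      ENNReal.rpow_one]
    rw [← mul_add, ← lintegral_add_left (hfm.pow_const _)]
    refine mul_le_mul_right (hmono.trans (lintegral_mono fun z => ENNReal.rpow_add_le_add_rpow _ _ h0.le ?_)) c
    rw [← ENNReal.toReal_one]
    exact ENNReal.toReal_mono ENNReal.one_ne_top h1

theorem fockENorm_eq_zero {p : ℝ≥0∞} [hp : Fact (0 < p)] {α : ℝ} (hα : 0 < α) {f : ℂ → ℂ}
    (hf : Continuous f) (h : fockENorm p α f = 0) : f = 0 := by
  unfold fockENorm at h
  have hpos : ∀ z : ℂ, ENNReal.ofReal (Real.exp (-(α / 2) * ‖z‖ ^ 2)) ≠ 0 := fun z => by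
    simp [Real.exp_pos]
  split_ifs at h with hi
  · funext z
    have := (ENNReal.iSup_eq_zero.1 h) z
    exact enorm_eq_zero.1 ((mul_eq_zero.1 this).resolve_right (hpos z))
  · have h0 : 0 < p.toReal := ENNReal.toReal_pos hp.out.ne' hi
    have hc : ENNReal.ofReal (α * p.toReal / (2 * Real.pi)) ≠ 0 := by
      have : 0 < α * p.toReal / (2 * Real.pi) := by positivity
      simpa using this
    have hm : Measurable fun z : ℂ =>
        (‖f z‖ₑ * ENNReal.ofReal (Real.exp (-(α / 2) * ‖z‖ ^ 2))) ^ p.toReal :=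
      (hf.measurable.enorm.mul (by fun_prop)).pow_const _
    rw [ENNReal.rpow_eq_zero_iff_of_pos (by positivity), mul_eq_zero, or_iff_right hc,
      lintegral_eq_zero_iff hm] at h
    refine (Continuous.ae_eq_iff_eq volume hf continuous_const).1 ?_
    filter_upwards [h] with z hz
    have hz' : ‖f z‖ₑ * ENNReal.ofReal (Real.exp (-(α / 2) * ‖z‖ ^ 2)) = 0 :=
      (ENNReal.rpow_eq_zero_iff_of_pos h0).1 hz
    exact enorm_eq_zero.1 ((mul_eq_zero.1 hz').resolve_right (hpos z))

/-- The entire functions with finite Fock norm, as a subspace of all functions `ℂ → ℂ`. -/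
def fockSubmodule (p : ℝ≥0∞) [Fact (0 < p)] (α : ℝ) : Submodule ℂ (ℂ → ℂ) where
  carrier := {f | Differentiable ℂ f ∧ fockENorm p α f < ∞}
  zero_mem' := ⟨differentiable_const 0, by rw [fockENorm_zero]; exact ENNReal.zero_lt_top⟩
  add_mem' := by
    rintro f g ⟨hf, hf'⟩ ⟨hg, hg'⟩
    refine ⟨hf.add hg, ?_⟩
    have hr := toReal_min_one_pos p
    have := (fockENorm_add_le p α hf.continuous hg.continuous).trans_lt
      (ENNReal.add_lt_top.2 ⟨(ENNReal.rpow_lt_top_iff_of_pos hr).2 hf',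
        (ENNReal.rpow_lt_top_iff_of_pos hr).2 hg'⟩)
    exact (ENNReal.rpow_lt_top_iff_of_pos hr).1 this
  smul_mem' := by
    rintro c f ⟨hf, hf'⟩
    refine ⟨hf.const_smul c, ?_⟩
    rw [fockENorm_const_smul]
    exact ENNReal.mul_lt_top enorm_lt_top hf'

/-- The Fock space `F^p_α`, as a type of its own: its topology is the one of the Fock norm and
not the topology of pointwise convergence. -/
def FockSpace (p : ℝ≥0∞) [Fact (0 < p)] (α : ℝ) : Type := fockSubmodule p α

namespace FockSpace

variable {p : ℝ≥0∞} [Fact (0 < p)] {α : ℝ}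

instance : AddCommGroup (FockSpace p α) := inferInstanceAs (AddCommGroup (fockSubmodule p α))

instance : Module ℂ (FockSpace p α) := inferInstanceAs (Module ℂ (fockSubmodule p α))

/-- The entire function underlying an element of the Fock space. -/
def toFun (f : FockSpace p α) : ℂ → ℂ := f.1

instance : CoeFun (FockSpace p α) fun _ => ℂ → ℂ := ⟨toFun⟩

instance : Norm (FockSpace p α) := ⟨fun f => (fockENorm p α f).toReal⟩

theorem rpow_norm_add_le (f g : FockSpace p α) :
    ‖f + g‖ ^ (min p 1).toReal ≤ ‖f‖ ^ (min p 1).toReal + ‖g‖ ^ (min p 1).toReal := by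
  have hr := toReal_min_one_pos p
  have h := fockENorm_add_le p α f.2.1.continuous g.2.1.continuous
  have hf := ((ENNReal.rpow_lt_top_iff_of_pos hr).2 f.2.2).ne
  have hg := ((ENNReal.rpow_lt_top_iff_of_pos hr).2 g.2.2).ne
  have := ENNReal.toReal_mono (ENNReal.add_ne_top.2 ⟨hf, hg⟩) h
  rw [ENNReal.toReal_add hf hg] at this
  simp only [← ENNReal.toReal_rpow] at this
  exact this

theorem norm_neg' (f : FockSpace p α) : ‖-f‖ = ‖f‖ :=
  congrArg ENNReal.toReal (fockENorm_neg p α f.1)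

/-- The metric of the Fock space: `d(f, g) = ‖f - g‖` if `1 ≤ p ≤ ∞` and
`d(f, g) = ‖f - g‖^p` if `0 < p < 1`. -/
instance [hα : Fact (0 < α)] : MetricSpace (FockSpace p α) where
  dist f g := ‖f - g‖ ^ (min p 1).toReal
  dist_self f := by
    have h : ‖f - f‖ = 0 := by
      rw [sub_self]
      exact congrArg ENNReal.toReal (fockENorm_zero p α)
    rw [h, Real.zero_rpow (toReal_min_one_pos p).ne']
  dist_comm f g := by rw [← norm_neg', neg_sub]
  dist_triangle f g h := by
    have := rpow_norm_add_le (f - g) (g - h)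
    rwa [sub_add_sub_cancel] at this
  eq_of_dist_eq_zero {f g} h := by
    have h1 : ‖f - g‖ = 0 :=
      (Real.rpow_eq_zero ENNReal.toReal_nonneg (toReal_min_one_pos p).ne').1 h
    have h2 : fockENorm p α (f - g).1 = 0 :=
      ((ENNReal.toReal_eq_zero_iff _).1 h1).resolve_right (f - g).2.2.ne
    have h3 := fockENorm_eq_zero hα.out (f - g).2.1.continuous h2
    exact sub_eq_zero.1 (Subtype.ext h3)

end FockSpace

/-- The Hausdorff operator `H_μ : F^p_α → F^q_α`,
`H_μ f (z) = ∫_0^∞ f(z/t) dμ(t)/t`, is well defined (the integral converges absolutely for all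
`f ∈ F^p_α` and `z ∈ ℂ`, and defines an element of `F^q_α`) and is a compact linear operator
(it maps a neighbourhood of the origin into a compact set). -/
def IsCompactHausdorff (μ : Measure (Set.Ioi (0 : ℝ))) (p q : ℝ≥0∞) [Fact (0 < p)]
    [Fact (0 < q)] (α : ℝ) [Fact (0 < α)] : Prop :=
  ∃ T : FockSpace p α →ₗ[ℂ] FockSpace q α,
    (∀ (f : FockSpace p α) (z : ℂ),
      Integrable (fun t : Set.Ioi (0 : ℝ) => f (z / ((t : ℝ) : ℂ)) / ((t : ℝ) : ℂ)) μ ∧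
      T f z = ∫ t : Set.Ioi (0 : ℝ), f (z / ((t : ℝ) : ℂ)) / ((t : ℝ) : ℂ) ∂μ) ∧
    IsCompactOperator T

end

/-!
Write `dν = dμ(t)/t`, a probability measure, so that `H_μ f (z) = ∫ f(z/t) dν(t)`.

Sufficiency. If `ν` lives on `(1, ∞)`, the operator averages dilations `f(s z)` with `0 < s < 1`.
For `p < 1` Minkowski's inequality is not available, and boundedness comes from a pointwise radial
maximal inequality instead (`exists_dilation_le_convolution`): all the numbers
`(|f(s z)| e^{-α|z|²/2})^p`, `0 ≤ s ≤ 1`, are at most a constant times the convolution of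
`(|f| e^{-α|·|²/2})^p` with a Gaussian. It follows from the sub-mean value property of `|F|^p`
(valid for every `p > 0` by Jensen's formula) on unit discs: if `|u - s z| < 1`, then
`|z - u| ≤ (1 - s)|z| + 1`, while passing from the weight at `s z` to the weight at `z` gains the
factor `e^{-α(1 - s²)|z|²/2} ≤ e^{-α((1 - s)|z|)²/2}`. Hence the norm of `H_μ` is at most a constant
times the mass of `ν` (`exists_fockENorm_hausdorff_le`), for all `p` at once.

For compactness, let `h_n` be bounded in the Fock space and tend to `0` locally uniformly, and split
`ν` at `1 + δ`. The part on `(1, 1 + δ]` has small mass, hence small norm. On `(1 + δ, ∞)` the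
dilations improve Gaussian growth: `h_n` tends to `0` uniformly with respect to the weight
`e^{-α(1 + δ)|z|²/2}`, and its image is dominated by a small multiple of `e^{α|z|²/(2(1 + δ))}`, which
has finite norm. So `H_μ h_n → 0` in norm (`tendsto_fockENorm_hausdorff`), and Montel's theorem and
Fatou's lemma show that the image of the closed unit ball is compact.

Necessity. Let `H_μ` be compact from the space of exponent `p` to that of exponent `q`. The kernels
`k_n(z) = e^{α n z - α n²/2}` have the same norm for all `n`. Applying well-definedness to `e^{α z²/4}`
gives `∫ e^{α R²/t²} dν(t) < ∞` for every `R`, which makes `H_μ k_n` tend to `0` pointwise. By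
compactness a subsequence converges in norm, necessarily to `0`, so by boundedness of point
evaluations `|H_μ k_n(n)| e^{-α n²/2}` tends to `0` along it. But this quantity is
`∫ e^{α n² (1/t - 1)} dν(t) ≥ ν((0, 1])`.
-/

open Filter Topology

/-! ### Sub-mean value property of powers of entire functions -/

/-- Subharmonicity of `log |F|`: in Jensen's formula the zeros of `F` contribute a nonnegative term. -/
theorem log_norm_le_circleAverage {F : ℂ → ℂ} (hF : Differentiable ℂ F) {c : ℂ} {r : ℝ}
    (hr : 0 < r) (hc : F c ≠ 0) :
    Real.log ‖F c‖ ≤ Real.circleAverage (fun z => Real.log ‖F z‖) c r := by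
  have hA : AnalyticOnNhd ℂ F (Metric.closedBall c |r|) := fun z _ => hF.analyticAt z
  rw [hA.circleAverage_log_norm hr.ne' hc]
  refine le_add_of_nonneg_left (finsum_nonneg fun u => ?_)
  by_cases hu : u ∈ Metric.closedBall c |r|
  · refine mul_nonneg (mod_cast MeromorphicOn.AnalyticOnNhd.divisor_nonneg hA u) ?_
    rcases eq_or_ne c u with rfl | hcu
    · simp
    · have h0 : 0 < ‖c - u‖ := norm_pos_iff.2 (sub_ne_zero.2 hcu)
      refine Real.log_nonneg ?_
      rw [Metric.mem_closedBall, dist_comm, dist_eq_norm, abs_of_pos hr] at hu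
      rw [← div_eq_mul_inv, le_div_iff₀ h0, one_mul]
      exact hu
  · simp [Function.locallyFinsuppWithin.apply_eq_zero_of_notMem _ hu]

/-- Subharmonicity of `|F| ^ p`, deduced from that of `log |F|`, so that `p < 1` is allowed. -/
theorem rpow_norm_le_circleAverage {F : ℂ → ℂ} (hF : Differentiable ℂ F) {c : ℂ} {r : ℝ}
    (hr : 0 < r) {p : ℝ} (hp : 0 < p) :
    ‖F c‖ ^ p ≤ Real.circleAverage (fun z => ‖F z‖ ^ p) c r := by
  rcases eq_or_ne (F c) 0 with h0 | h0
  · rw [h0, norm_zero, Real.zero_rpow hp.ne']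
    exact Real.circleAverage_nonneg_of_nonneg fun z _ => by positivity
  have hpos : 0 < ‖F c‖ := norm_pos_iff.2 h0
  -- The inequality `e * log x ≤ x` also holds for the junk value `log 0 = 0`; normalizing `F` so
  -- that `‖F c‖ ^ p = e` gives equality at the center.
  set l : ℝ := Real.exp (1 / p) / ‖F c‖ with hl
  have hlpos : 0 < l := by positivity
  set G : ℂ → ℂ := fun z => (l : ℂ) * F z with hG
  have hGd : Differentiable ℂ G := hF.const_mul _
  have hGn : ∀ z, ‖G z‖ = l * ‖F z‖ := fun z => by
    simp [hG, abs_of_pos hlpos]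
  have hGc : ‖G c‖ = Real.exp (1 / p) := by
    rw [hGn, hl, div_mul_cancel₀ _ hpos.ne']
  have hGc0 : G c ≠ 0 := by
    rw [← norm_pos_iff, hGc]; positivity
  have hpt : ∀ x : ℝ, 0 ≤ x → (Real.exp 1 * p) * Real.log x ≤ x ^ p := by
    intro x hx
    rcases hx.eq_or_lt with rfl | hx
    · simp [Real.zero_rpow hp.ne']
    · have h1 : x ^ p = Real.exp (p * Real.log x) := by
        rw [Real.rpow_def_of_pos hx, mul_comm]
      have h2 := Real.add_one_le_exp (p * Real.log x - 1)
      rw [Real.exp_sub, le_div_iff₀ (Real.exp_pos 1)] at h2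
      rw [h1]; linarith
  have hci : CircleIntegrable (fun z => Real.log ‖G z‖) c r :=
    MeromorphicOn.circleIntegrable_log_norm fun z _ => (hGd.analyticAt z).meromorphicAt
  have hci2 : CircleIntegrable (fun z => ‖G z‖ ^ p) c r :=
    ((hGd.continuous.norm.rpow_const fun _ => Or.inr hp.le).continuousOn).circleIntegrable hr.le
  have h1 := log_norm_le_circleAverage hGd hr hGc0
  have h2 : Real.circleAverage (fun z => (Real.exp 1 * p) • Real.log ‖G z‖) c r ≤
      Real.circleAverage (fun z => ‖G z‖ ^ p) c r :=
    Real.circleAverage_mono (hci.const_smul (a := Real.exp 1 * p)) hci2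
      fun z _ => hpt _ (norm_nonneg _)
  rw [Real.circleAverage_fun_smul] at h2
  have h3 : Real.circleAverage (fun z => ‖G z‖ ^ p) c r =
      l ^ p * Real.circleAverage (fun z => ‖F z‖ ^ p) c r := by
    rw [← smul_eq_mul, ← Real.circleAverage_fun_smul]
    congr 1; ext z
    rw [hGn, Real.mul_rpow hlpos.le (norm_nonneg _), smul_eq_mul]
  have h4 : l ^ p * ‖F c‖ ^ p = Real.exp 1 := by
    rw [← Real.mul_rpow hlpos.le (norm_nonneg _), ← hGn, hGc, ← Real.exp_mul]
    congr 1; field_simp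
  rw [hGc, Real.log_exp] at h1
  have h5 : Real.exp 1 ≤ (Real.exp 1 * p) • Real.circleAverage (fun z => Real.log ‖G z‖) c r := by
    calc Real.exp 1 = (Real.exp 1 * p) * (1 / p) := by field_simp
      _ ≤ _ := mul_le_mul_of_nonneg_left h1 (by positivity)
  have h6 := h5.trans (h2.trans_eq h3)
  rw [← h4] at h6
  exact le_of_mul_le_mul_left h6 (by positivity)

/-- The sub-mean value inequality on the circle of radius `r`, in polar coordinates. -/
theorem lintegral_rpow_enorm_ge {F : ℂ → ℂ} (hF : Differentiable ℂ F) {r : ℝ}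
    (hr : 0 < r) {p : ℝ} (hp : 0 < p) :
    ∫⁻ _ in Set.Ioo (-Real.pi) Real.pi, ‖F 0‖ₑ ^ p ≤
      ∫⁻ θ in Set.Ioo (-Real.pi) Real.pi, ‖F (Complex.polarCoord.symm (r, θ))‖ₑ ^ p := by
  have key := rpow_norm_le_circleAverage hF (c := 0) hr hp
  rw [Real.circleAverage_eq_integral_add (-Real.pi)] at key
  have hpi := Real.pi_pos
  set φ : ℝ → ℝ := fun θ => ‖F (circleMap 0 r θ)‖ ^ p with hφ
  have hcont : Continuous φ :=
    (hF.continuous.comp (continuous_circleMap 0 r)).norm.rpow_const fun _ => Or.inr hp.le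
  have e1 : ∫ θ in (0)..(2 * Real.pi), φ (θ + -Real.pi) = ∫ θ in (-Real.pi)..Real.pi, φ θ := by
    rw [intervalIntegral.integral_comp_add_right]; congr 1 <;> ring
  have e2 : ∀ x, ‖x‖ₑ ^ p = ENNReal.ofReal (‖x‖ ^ p) := fun x : ℂ => by
    rw [← ofReal_norm, ENNReal.ofReal_rpow_of_nonneg (norm_nonneg _) hp.le]
  have e3 : ∀ θ, Complex.polarCoord.symm (r, θ) = circleMap 0 r θ := fun θ => by
    rw [Complex.polarCoord_symm_apply, circleMap, zero_add, Complex.exp_mul_I,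
      Complex.ofReal_cos, Complex.ofReal_sin]
  simp only [e2, e3]
  rw [← ofReal_integral_eq_lintegral_ofReal, ← ofReal_integral_eq_lintegral_ofReal]
  · refine ENNReal.ofReal_le_ofReal ?_
    rw [← integral_Ioc_eq_integral_Ioo, ← integral_Ioc_eq_integral_Ioo,
      ← intervalIntegral.integral_of_le (by linarith),
      ← intervalIntegral.integral_of_le (by linarith), intervalIntegral.integral_const]
    rw [e1, smul_eq_mul, ← div_eq_inv_mul, le_div_iff₀ (by positivity)] at key
    rw [smul_eq_mul]
    calc _ = ‖F 0‖ ^ p * (2 * Real.pi) := by ring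
      _ ≤ _ := key
  · exact (hcont.integrableOn_Icc (a := -Real.pi) (b := Real.pi)).mono_set Set.Ioo_subset_Icc_self
  · exact Filter.Eventually.of_forall fun θ => by positivity
  · exact integrable_const _
  · exact Filter.Eventually.of_forall fun θ => by positivity

/-- The area sub-mean value property of `|F| ^ p` for every `p > 0`. -/
theorem rpow_enorm_mul_volume_ball_le {F : ℂ → ℂ} (hF : Differentiable ℂ F) {p : ℝ} (hp : 0 < p) :
    ‖F 0‖ₑ ^ p * volume (Metric.ball (0 : ℂ) 1) ≤ ∫⁻ z in Metric.ball (0 : ℂ) 1, ‖F z‖ₑ ^ p := by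
  have hm : ∀ G : ℂ → ℂ, Continuous G → Measurable fun q : ℝ × ℝ => ENNReal.ofReal q.1 •
      (Metric.ball (0 : ℂ) 1).indicator (fun z => ‖G z‖ₑ ^ p) (Complex.polarCoord.symm q) := by
    intro G hG
    have h1 : Measurable fun q : ℝ × ℝ => (Complex.polarCoord.symm q : ℂ) := by
      simp only [Complex.polarCoord_symm_apply]
      fun_prop
    refine (ENNReal.measurable_ofReal.comp measurable_fst).smul
      (Measurable.comp (Measurable.indicator ?_ Metric.isOpen_ball.measurableSet) h1)
    exact hG.measurable.enorm.pow_const _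
  rw [← setLIntegral_const, ← lintegral_indicator Metric.isOpen_ball.measurableSet,
    ← lintegral_indicator Metric.isOpen_ball.measurableSet,
    ← Complex.lintegral_comp_polarCoord_symm, ← Complex.lintegral_comp_polarCoord_symm,
    polarCoord_target, Measure.volume_eq_prod, ← Measure.prod_restrict,
    lintegral_prod _ (hm (fun _ => F 0) continuous_const).aemeasurable,
    lintegral_prod _ (hm F hF.continuous).aemeasurable]
  refine setLIntegral_mono' measurableSet_Ioi fun r hr => ?_
  have hr' : (0 : ℝ) < r := hr
  have hmem : ∀ θ, (Complex.polarCoord.symm (r, θ) ∈ Metric.ball (0 : ℂ) 1) ↔ r < 1 := fun θ => by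
    rw [mem_ball_zero_iff, Complex.norm_polarCoord_symm, abs_of_pos hr']
  by_cases h1 : r < 1
  · simp only [Set.indicator, hmem, h1, if_true, smul_eq_mul]
    rw [lintegral_const_mul' _ _ (by simp), lintegral_const_mul' _ _ (by simp)]
    refine mul_le_mul_right ?_ _
    exact lintegral_rpow_enorm_ge hF hr' hp
  · simp only [Set.indicator, hmem, h1, if_false, smul_zero, lintegral_zero, le_refl]

/-! ### Gaussian integrals -/

theorem integrable_exp_neg_mul_norm_sq {b : ℝ} (hb : 0 < b) :
    Integrable fun z : ℂ => Real.exp (-b * ‖z‖ ^ 2) := by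
  have h := (GaussianFourier.integrable_cexp_neg_mul_sq_norm_add (V := ℂ) (b := (b : ℂ))
    (by simpa using hb) 0 0).norm
  refine h.congr (Filter.Eventually.of_forall fun z => ?_)
  simp only [Complex.norm_exp]
  congr 1
  have : (-(b : ℂ) * (‖z‖ : ℂ) ^ 2 + 0 * ((inner ℝ (0 : ℂ) z : ℝ) : ℂ)) =
    ((-b * ‖z‖ ^ 2 : ℝ) : ℂ) := by push_cast; ring
  rw [this, Complex.ofReal_re]

theorem lintegral_exp_neg_mul_norm_sq_ne_top {b : ℝ} (hb : 0 < b) :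
    ∫⁻ z : ℂ, ENNReal.ofReal (Real.exp (-b * ‖z‖ ^ 2)) ≠ ∞ :=
  (lintegral_ofReal_ne_top_iff_integrable (by fun_prop)
    (Filter.Eventually.of_forall fun _ => (Real.exp_pos _).le)).2
      (integrable_exp_neg_mul_norm_sq hb)

/-! ### The Fock density and the radial maximal inequality -/

/-- The Gaussian weight `e^{-α|z|²/2}` of the Fock norms. -/
noncomputable def fockWeight (α : ℝ) (z : ℂ) : ℝ≥0∞ := ENNReal.ofReal (Real.exp (-(α / 2) * ‖z‖ ^ 2))

theorem measurable_fockWeight (α : ℝ) : Measurable (fockWeight α) := by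
  unfold fockWeight; fun_prop

theorem fockWeight_ne_zero (α : ℝ) (z : ℂ) : fockWeight α z ≠ 0 := by
  simp [fockWeight, Real.exp_pos]

theorem fockWeight_ne_top (α : ℝ) (z : ℂ) : fockWeight α z ≠ ∞ := ENNReal.ofReal_ne_top

theorem fockENorm_top (α : ℝ) (f : ℂ → ℂ) :
    fockENorm ∞ α f = ⨆ z, ‖f z‖ₑ * fockWeight α z := by
  simp [fockENorm, fockWeight]

theorem fockENorm_of_ne_top {p : ℝ≥0∞} (hp : p ≠ ∞) (α : ℝ) (f : ℂ → ℂ) :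
    fockENorm p α f = (ENNReal.ofReal (α * p.toReal / (2 * Real.pi)) *
      ∫⁻ z, (‖f z‖ₑ * fockWeight α z) ^ p.toReal) ^ (1 / p.toReal) := by
  simp [fockENorm, fockWeight, hp]

theorem measurable_fockDensity {f : ℂ → ℂ} (hf : Continuous f) (α q : ℝ) :
    Measurable fun z => (‖f z‖ₑ * fockWeight α z) ^ q :=
  (hf.measurable.enorm.mul (measurable_fockWeight α)).pow_const _

/-- Sub-mean value inequality for the Fock density: multiplying `f` by the exponential
`e^{-α (conj w) ζ - α|w|²/2}` makes the modulus of `f (w + ζ)` equal to its weighted modulus at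
`w + ζ` times `e^{α|ζ|²/2}`, which is bounded on the unit disc. -/
theorem fockDensity_le_lintegral {f : ℂ → ℂ} (hf : Differentiable ℂ f) {α : ℝ} (hα : 0 < α)
    {q : ℝ} (hq : 0 < q) (w : ℂ) :
    (‖f w‖ₑ * fockWeight α w) ^ q * volume (Metric.ball (0 : ℂ) 1) ≤
      ENNReal.ofReal (Real.exp (α / 2)) ^ q *
        ∫⁻ ζ in Metric.ball (0 : ℂ) 1, (‖f (w + ζ)‖ₑ * fockWeight α (w + ζ)) ^ q := by
  set F : ℂ → ℂ := fun ζ => f (w + ζ) *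
    Complex.exp (-(α : ℂ) * (starRingEnd ℂ w) * ζ - ((α / 2 * ‖w‖ ^ 2 : ℝ) : ℂ)) with hF
  have hFd : Differentiable ℂ F := by
    refine (hf.comp (differentiable_id.const_add w)).mul ?_
    fun_prop
  have hn : ∀ ζ, ‖F ζ‖ₑ = ‖f (w + ζ)‖ₑ * fockWeight α (w + ζ) *
      ENNReal.ofReal (Real.exp (α / 2 * ‖ζ‖ ^ 2)) := by
    intro ζ
    rw [fockWeight, mul_assoc, ← ENNReal.ofReal_mul (Real.exp_pos _).le, ← Real.exp_add,
      hF, enorm_mul]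
    congr 1
    rw [← ofReal_norm, Complex.norm_exp]
    congr 2
    have h1 : ‖w + ζ‖ ^ 2 = ‖w‖ ^ 2 + ‖ζ‖ ^ 2 + 2 * ((starRingEnd ℂ w) * ζ).re := by
      rw [← Complex.normSq_eq_norm_sq, ← Complex.normSq_eq_norm_sq, ← Complex.normSq_eq_norm_sq,
        Complex.normSq_apply, Complex.normSq_apply, Complex.normSq_apply]
      simp
      ring
    rw [h1, Complex.sub_re, Complex.ofReal_re, mul_assoc,
      show -(α : ℂ) = ((-α : ℝ) : ℂ) by push_cast; rfl, Complex.re_ofReal_mul]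
    ring
  have h0 := rpow_enorm_mul_volume_ball_le hFd hq
  have hF0 : ‖F 0‖ₑ = ‖f w‖ₑ * fockWeight α w := by
    rw [hn 0]; simp
  rw [hF0] at h0
  refine h0.trans ?_
  rw [← lintegral_const_mul' _ _ (ENNReal.rpow_ne_top_of_nonneg hq.le ENNReal.ofReal_ne_top)]
  refine setLIntegral_mono' Metric.isOpen_ball.measurableSet fun ζ hζ => ?_
  rw [hn, mul_comm, ENNReal.mul_rpow_of_nonneg _ _ hq.le]
  gcongr
  have : ‖ζ‖ < 1 := mem_ball_zero_iff.1 hζ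
  have h2 : ‖ζ‖ ^ 2 ≤ 1 := by nlinarith [norm_nonneg ζ]
  nlinarith

theorem fockWeight_eq_smul (α : ℝ) (s : ℝ) (z : ℂ) :
    fockWeight α z = fockWeight α ((s : ℂ) * z) *
      ENNReal.ofReal (Real.exp (-(α / 2) * ((1 - s ^ 2) * ‖z‖ ^ 2))) := by
  rw [fockWeight, fockWeight, ← ENNReal.ofReal_mul (Real.exp_pos _).le, ← Real.exp_add]
  congr 2
  rw [norm_mul, mul_pow, Complex.norm_real, Real.norm_eq_abs, sq_abs]
  ring

/-- The geometry behind the radial maximal inequality: if `u` lies within distance `1` of `s z`,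
then `|z - u| ≤ (1 - s)|z| + 1`, while the weight at `z` gains `(1 - s²)|z|² ≥ ((1 - s)|z|)²`. -/
theorem half_norm_sub_sq_le {s : ℝ} (hs0 : 0 ≤ s) (hs1 : s ≤ 1) (z : ℂ) {ζ : ℂ} (hζ : ‖ζ‖ < 1) :
    ‖z - ((s : ℂ) * z + ζ)‖ ^ 2 / 2 ≤ (1 - s ^ 2) * ‖z‖ ^ 2 + 1 := by
  have h1 : ‖z - ((s : ℂ) * z + ζ)‖ ≤ (1 - s) * ‖z‖ + 1 := by
    calc ‖z - ((s : ℂ) * z + ζ)‖ = ‖((1 - s : ℝ) : ℂ) * z - ζ‖ := by congr 1; push_cast; ring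
      _ ≤ ‖((1 - s : ℝ) : ℂ) * z‖ + ‖ζ‖ := norm_sub_le _ _
      _ ≤ _ := by
        rw [norm_mul, Complex.norm_real, Real.norm_eq_abs, abs_of_nonneg (by linarith)]
        linarith
  have hd : 0 ≤ (1 - s) * ‖z‖ := mul_nonneg (by linarith) (norm_nonneg z)
  have h2 : ((1 - s) * ‖z‖) ^ 2 ≤ (1 - s ^ 2) * ‖z‖ ^ 2 := by
    rw [mul_pow]
    gcongr
    nlinarith
  have h3 := pow_le_pow_left₀ (norm_nonneg _) h1 2
  nlinarith [sq_nonneg ((1 - s) * ‖z‖ - 1)]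

/-- Radial maximal inequality: the supremum over `0 ≤ s ≤ 1` of `(|f (s z)| e^{-α|z|²/2}) ^ q` is
controlled by a Gaussian convolution of the Fock density of `f`. -/
theorem exists_dilation_le_convolution {α : ℝ} (hα : 0 < α) {q : ℝ} (hq : 0 < q) :
    ∃ C : ℝ≥0∞, C ≠ ∞ ∧ ∀ f : ℂ → ℂ, Differentiable ℂ f → ∀ s : ℝ, 0 ≤ s → s ≤ 1 → ∀ z : ℂ,
      (‖f ((s : ℂ) * z)‖ₑ * fockWeight α z) ^ q ≤
        C * ∫⁻ u, (‖f u‖ₑ * fockWeight α u) ^ q *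
          ENNReal.ofReal (Real.exp (-(α * q / 4) * ‖z - u‖ ^ 2)) := by
  set V := volume (Metric.ball (0 : ℂ) 1) with hV
  have hV0 : V ≠ 0 := (Metric.measure_ball_pos _ _ one_pos).ne'
  have hVt : V ≠ ∞ := measure_ball_lt_top.ne
  set E := ENNReal.ofReal (Real.exp (α / 2)) ^ q with hE
  have hEt : E ≠ ∞ := ENNReal.rpow_ne_top_of_nonneg hq.le ENNReal.ofReal_ne_top
  set B := ENNReal.ofReal (Real.exp (α * q / 2)) with hB
  refine ⟨V⁻¹ * E * B, ENNReal.mul_ne_top (ENNReal.mul_ne_top (ENNReal.inv_ne_top.2 hV0) hEt)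
    ENNReal.ofReal_ne_top, fun f hf s hs0 hs1 z => ?_⟩
  set g : ℂ → ℝ≥0∞ := fun u => (‖f u‖ₑ * fockWeight α u) ^ q with hg
  set D := ENNReal.ofReal (Real.exp (-(α / 2) * ((1 - s ^ 2) * ‖z‖ ^ 2))) ^ q with hD
  have hDt : D ≠ ∞ := ENNReal.rpow_ne_top_of_nonneg hq.le ENNReal.ofReal_ne_top
  have h1 : (‖f ((s : ℂ) * z)‖ₑ * fockWeight α z) ^ q = g (s * z) * D := by
    rw [fockWeight_eq_smul α s z, ← mul_assoc, ENNReal.mul_rpow_of_nonneg _ _ hq.le]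
  have h2 : g (s * z) ≤ V⁻¹ * (E * ∫⁻ ζ in Metric.ball (0 : ℂ) 1, g (s * z + ζ)) := by
    have := fockDensity_le_lintegral hf hα hq ((s : ℂ) * z)
    rw [mul_comm V⁻¹, ← div_eq_mul_inv]
    exact (ENNReal.le_div_iff_mul_le (Or.inl hV0) (Or.inl hVt)).2 this
  have h3 : (∫⁻ ζ in Metric.ball (0 : ℂ) 1, g (s * z + ζ)) * D ≤
      B * ∫⁻ u, g u * ENNReal.ofReal (Real.exp (-(α * q / 4) * ‖z - u‖ ^ 2)) := by
    rw [← lintegral_mul_const' _ _ hDt, ← lintegral_const_mul' _ _ ENNReal.ofReal_ne_top,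
      ← lintegral_add_left_eq_self (μ := volume) (fun u => B * (g u *
        ENNReal.ofReal (Real.exp (-(α * q / 4) * ‖z - u‖ ^ 2)))) ((s : ℂ) * z)]
    refine (setLIntegral_mono' Metric.isOpen_ball.measurableSet fun ζ hζ => ?_).trans
      (setLIntegral_le_lintegral (Metric.ball (0 : ℂ) 1) _)
    rw [mul_left_comm]
    refine mul_le_mul_right ?_ _
    rw [hD, hB, ENNReal.ofReal_rpow_of_nonneg (Real.exp_pos _).le hq.le,
      ← ENNReal.ofReal_mul (Real.exp_pos _).le, ← Real.exp_mul, ← Real.exp_add]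
    refine ENNReal.ofReal_le_ofReal (Real.exp_le_exp.2 ?_)
    have := half_norm_sub_sq_le hs0 hs1 z (mem_ball_zero_iff.1 hζ)
    nlinarith [mul_le_mul_of_nonneg_left this (by positivity : 0 ≤ α * q / 2)]
  rw [h1]
  calc g (s * z) * D ≤ V⁻¹ * (E * ∫⁻ ζ in Metric.ball (0 : ℂ) 1, g (s * z + ζ)) * D := by
        gcongr
    _ = V⁻¹ * E * ((∫⁻ ζ in Metric.ball (0 : ℂ) 1, g (s * z + ζ)) * D) := by ring
    _ ≤ V⁻¹ * E * (B * ∫⁻ u, g u * ENNReal.ofReal (Real.exp (-(α * q / 4) * ‖z - u‖ ^ 2))) := by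
        gcongr
    _ = _ := by ring

/-- Point evaluations are bounded on Fock spaces, with the sharp growth `e^{α|z|²/2}`. -/
theorem exists_enorm_mul_fockWeight_le {α : ℝ} (hα : 0 < α) (p : ℝ≥0∞) (hp : 0 < p) :
    ∃ C : ℝ≥0∞, C ≠ ∞ ∧ ∀ f : ℂ → ℂ, Differentiable ℂ f → ∀ z : ℂ,
      ‖f z‖ₑ * fockWeight α z ≤ C * fockENorm p α f := by
  by_cases hi : p = ∞
  · subst hi
    refine ⟨1, ENNReal.one_ne_top, fun f _ z => ?_⟩
    rw [one_mul, fockENorm_top]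
    exact le_iSup (fun z => ‖f z‖ₑ * fockWeight α z) z
  have hq : 0 < p.toReal := ENNReal.toReal_pos hp.ne' hi
  set q := p.toReal with hqdef
  obtain ⟨C, hC, h⟩ := exists_dilation_le_convolution hα hq
  set c := ENNReal.ofReal (α * q / (2 * Real.pi)) with hc
  have hc0 : c ≠ 0 := by
    have : 0 < α * q / (2 * Real.pi) := by positivity
    simpa [hc] using this
  refine ⟨(C * c⁻¹) ^ (1 / q), ENNReal.rpow_ne_top_of_nonneg (by positivity)
    (ENNReal.mul_ne_top hC (ENNReal.inv_ne_top.2 hc0)), fun f hf z => ?_⟩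
  have h1 := h f hf 1 zero_le_one le_rfl z
  rw [Complex.ofReal_one, one_mul] at h1
  have h2 : (‖f z‖ₑ * fockWeight α z) ^ q ≤
      (C * c⁻¹) * (c * ∫⁻ u, (‖f u‖ₑ * fockWeight α u) ^ q) := by
    rw [mul_assoc, ← mul_assoc c⁻¹, ENNReal.inv_mul_cancel hc0 ENNReal.ofReal_ne_top, one_mul]
    refine h1.trans (mul_le_mul_right (lintegral_mono fun u => ?_) C)
    refine mul_le_of_le_one_right' ?_
    rw [ENNReal.ofReal_le_one, Real.exp_le_one_iff]
    have : 0 ≤ α * q / 4 * ‖z - u‖ ^ 2 := by positivity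
    linarith
  rw [fockENorm_of_ne_top hi, ← hqdef, ← ENNReal.mul_rpow_of_nonneg _ _ (by positivity)]
  refine le_trans ?_ (ENNReal.rpow_le_rpow h2 (by positivity : 0 ≤ 1 / q))
  rw [← ENNReal.rpow_mul, mul_one_div_cancel hq.ne', ENNReal.rpow_one]

theorem fockENorm_le_of_enorm_le {p : ℝ≥0∞} {α : ℝ} {f g : ℂ → ℂ}
    (h : ∀ z, ‖f z‖ₑ ≤ ‖g z‖ₑ) : fockENorm p α f ≤ fockENorm p α g := by
  unfold fockENorm
  split_ifs with hi
  · gcongr with z; exact h z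
  · gcongr with z; exact h z

/-- Functions of strictly smaller Gaussian growth lie in every Fock space. -/
theorem fockENorm_exp_mul_norm_sq_ne_top {α b : ℝ} (hb : b < α / 2) {p : ℝ≥0∞}
    (hp : 0 < p) : fockENorm p α (fun z => (Real.exp (b * ‖z‖ ^ 2) : ℂ)) ≠ ∞ := by
  have key : ∀ z : ℂ, ‖(Real.exp (b * ‖z‖ ^ 2) : ℂ)‖ₑ * fockWeight α z =
      ENNReal.ofReal (Real.exp (-(α / 2 - b) * ‖z‖ ^ 2)) := fun z => by
    rw [← ofReal_norm, Complex.norm_real, Real.norm_eq_abs, abs_of_pos (Real.exp_pos _),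
      fockWeight, ← ENNReal.ofReal_mul (Real.exp_pos _).le, ← Real.exp_add]
    congr 2; ring
  by_cases hi : p = ∞
  · subst hi
    rw [fockENorm_top]
    refine ne_top_of_le_ne_top ENNReal.one_ne_top (iSup_le fun z => ?_)
    rw [key, ENNReal.ofReal_le_one, Real.exp_le_one_iff]
    have : 0 ≤ (α / 2 - b) * ‖z‖ ^ 2 := mul_nonneg (by linarith) (by positivity)
    linarith
  · have hq : 0 < p.toReal := ENNReal.toReal_pos hp.ne' hi
    rw [fockENorm_of_ne_top hi]
    refine ENNReal.rpow_ne_top_of_nonneg (by positivity)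
      (ENNReal.mul_ne_top ENNReal.ofReal_ne_top ?_)
    refine ne_top_of_le_ne_top (lintegral_exp_neg_mul_norm_sq_ne_top
      (mul_pos (sub_pos.2 hb) hq)) (lintegral_mono fun z => le_of_eq ?_)
    rw [key, ENNReal.ofReal_rpow_of_nonneg (Real.exp_pos _).le hq.le, ← Real.exp_mul]
    congr 2; ring

/-! ### Normal families and lower semicontinuity -/

/-- Montel's theorem for sequences of entire functions. -/
theorem exists_subseq_tendstoLocallyUniformly {f : ℕ → ℂ → ℂ} (hf : ∀ n, Differentiable ℂ (f n))
    (hb : ∀ R : ℝ, ∃ C : ℝ, ∀ n, ∀ z ∈ Metric.closedBall (0 : ℂ) R, ‖f n z‖ ≤ C) :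
    ∃ (g : ℂ → ℂ) (φ : ℕ → ℕ), Differentiable ℂ g ∧ StrictMono φ ∧
      TendstoLocallyUniformly (fun n => f (φ n)) g atTop := by
  set F : ℕ → C(ℂ, ℂ) := fun n => ⟨f n, (hf n).continuous⟩ with hF
  have heq : Equicontinuous ((fun g : C(ℂ, ℂ) => (g : ℂ → ℂ)) ∘
      ((↑) : Set.range F → C(ℂ, ℂ))) := by
    intro z₀
    obtain ⟨C, hC⟩ := hb (‖z₀‖ + 2)
    have hC0 : 0 ≤ C := (norm_nonneg _).trans (hC 0 0 (by simp; positivity))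
    refine Metric.equicontinuousAt_of_continuity_modulus (fun z => C * ‖z - z₀‖) ?_ _ ?_
    · have : Continuous fun z : ℂ => C * ‖z - z₀‖ := by fun_prop
      simpa using this.tendsto z₀
    · filter_upwards [Metric.ball_mem_nhds z₀ one_pos] with z hz
      rintro ⟨_, n, rfl⟩
      change dist (f n z₀) (f n z) ≤ _
      rw [dist_comm, dist_eq_norm]
      refine (convex_ball z₀ 1).norm_image_sub_le_of_norm_deriv_le
        (fun x _ => (hf n) x) (fun x hx => ?_) (Metric.mem_ball_self one_pos) hz
      rw [← div_one C]
      refine Complex.norm_deriv_le_of_forall_mem_sphere_norm_le one_pos (hf n).diffContOnCl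
        fun w hw => hC n w ?_
      rw [mem_closedBall_zero_iff]
      have h1 : ‖w - x‖ = 1 := by rwa [mem_sphere_iff_norm] at hw
      have h2 : ‖x - z₀‖ < 1 := by rwa [mem_ball_iff_norm] at hx
      calc ‖w‖ = ‖(w - x) + (x - z₀) + z₀‖ := by congr 1; ring
        _ ≤ ‖w - x‖ + ‖x - z₀‖ + ‖z₀‖ := norm_add₃_le
        _ ≤ _ := by linarith
  have hcomp : IsCompact (closure (Set.range F)) := by
    have : T2Space (UniformOnFun ℂ ℂ {K : Set ℂ | IsCompact K}) :=
      UniformOnFun.t2Space_of_covering (Set.eq_univ_of_forall fun x =>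
        Set.mem_sUnion_of_mem (Set.mem_singleton x) isCompact_singleton)
    refine ArzelaAscoli.isCompact_closure_of_isClosedEmbedding (𝔖 := {K : Set ℂ | IsCompact K})
      (F := fun g : C(ℂ, ℂ) => (g : ℂ → ℂ)) (fun K hK => hK)
      ContinuousMap.isUniformEmbedding_toUniformOnFunIsCompact.isClosedEmbedding
      (fun K _ => heq.equicontinuousOn K) fun K _ z _ => ?_
    obtain ⟨C, hC⟩ := hb ‖z‖
    refine ⟨Metric.closedBall 0 C, isCompact_closedBall _ _, ?_⟩
    rintro _ ⟨n, rfl⟩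
    exact mem_closedBall_zero_iff.2 (hC n z (by simp))
  obtain ⟨g, -, φ, hφ, hlim⟩ := hcomp.isSeqCompact fun n => subset_closure (Set.mem_range_self n)
  have hlu : TendstoLocallyUniformly (fun n => f (φ n)) g atTop :=
    ContinuousMap.tendsto_iff_tendstoLocallyUniformly.1 hlim
  refine ⟨g, φ, ?_, hφ, hlu⟩
  rw [← differentiableOn_univ]
  exact (tendstoLocallyUniformlyOn_univ.2 hlu).differentiableOn
    (Eventually.of_forall fun n => (hf _).differentiableOn) isOpen_univ

/-- Fatou's lemma: the Fock norms are lower semicontinuous under pointwise convergence. -/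
theorem fockENorm_le_of_tendsto {p : ℝ≥0∞} (hp : 0 < p) {α : ℝ} (hα : 0 < α) {f : ℕ → ℂ → ℂ}
    {g : ℂ → ℂ} (hf : ∀ n, Continuous (f n)) (hlim : ∀ z, Tendsto (fun n => f n z) atTop (𝓝 (g z)))
    {M : ℝ≥0∞} (hM : ∀ n, fockENorm p α (f n) ≤ M) : fockENorm p α g ≤ M := by
  have h1 : ∀ z, Tendsto (fun n => ‖f n z‖ₑ * fockWeight α z) atTop
      (𝓝 (‖g z‖ₑ * fockWeight α z)) := fun z =>
    ENNReal.Tendsto.mul_const (hlim z).enorm (Or.inr (fockWeight_ne_top α z))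
  by_cases hi : p = ∞
  · subst hi
    simp only [fockENorm_top] at hM ⊢
    exact iSup_le fun z => le_of_tendsto' (h1 z) fun n =>
      (le_iSup (fun z => ‖f n z‖ₑ * fockWeight α z) z).trans (hM n)
  have hq : 0 < p.toReal := ENNReal.toReal_pos hp.ne' hi
  set q := p.toReal with hqdef
  set c := ENNReal.ofReal (α * q / (2 * Real.pi)) with hc
  have hc0 : c ≠ 0 := by
    have : 0 < α * q / (2 * Real.pi) := by positivity
    simpa [hc] using this
  have hct : c ≠ ∞ := ENNReal.ofReal_ne_top
  have hiff : ∀ h : ℂ → ℂ, fockENorm p α h ≤ M ↔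
      ∫⁻ z, (‖h z‖ₑ * fockWeight α z) ^ q ≤ M ^ q / c := fun h => by
    rw [fockENorm_of_ne_top hi, ← hqdef, ENNReal.le_div_iff_mul_le (Or.inl hc0) (Or.inl hct),
      mul_comm c, one_div, ENNReal.rpow_inv_le_iff hq]
  rw [hiff]
  calc ∫⁻ z, (‖g z‖ₑ * fockWeight α z) ^ q
      = ∫⁻ z, liminf (fun n => (‖f n z‖ₑ * fockWeight α z) ^ q) atTop := by
        refine lintegral_congr fun z => ?_
        exact ((h1 z).ennrpow_const q).liminf_eq.symm
    _ ≤ liminf (fun n => ∫⁻ z, (‖f n z‖ₑ * fockWeight α z) ^ q) atTop :=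
        lintegral_liminf_le fun n => measurable_fockDensity (hf n) α q
    _ ≤ liminf (fun _ : ℕ => M ^ q / c) atTop :=
        liminf_le_liminf (Eventually.of_forall fun n => (hiff _).1 (hM n))
    _ = _ := liminf_const _

/-! ### Hausdorff operators of measures on `(1, ∞)` -/

/-- The total mass `∫ dμ(t)/t` of the measure `dμ(t)/t`. -/
noncomputable def hausdorffMass (μ : Measure (Set.Ioi (0 : ℝ))) : ℝ≥0∞ :=
  ∫⁻ t : Set.Ioi (0 : ℝ), ENNReal.ofReal (1 / (t : ℝ)) ∂μ

/-- The Hausdorff operator `f ↦ ∫ f(z/t) dμ(t)/t`, on arbitrary functions. -/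
noncomputable def hausdorff (μ : Measure (Set.Ioi (0 : ℝ))) (f : ℂ → ℂ) (z : ℂ) : ℂ :=
  ∫ t : Set.Ioi (0 : ℝ), f (z / ((t : ℝ) : ℂ)) / ((t : ℝ) : ℂ) ∂μ

section Hausdorff

variable {μ : Measure (Set.Ioi (0 : ℝ))}

theorem enorm_div_coe (w : ℂ) (t : Set.Ioi (0 : ℝ)) :
    ‖w / ((t : ℝ) : ℂ)‖ₑ = ‖w‖ₑ * ENNReal.ofReal (1 / (t : ℝ)) := by
  rw [div_eq_mul_one_div, enorm_mul, ← ofReal_norm (1 / ((t : ℝ) : ℂ)), norm_div, norm_one,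
    Complex.norm_real, Real.norm_eq_abs, abs_of_pos t.2]

theorem measurable_hausdorff_integrand {f : ℂ → ℂ} (hf : Continuous f) (z : ℂ) :
    Measurable fun t : Set.Ioi (0 : ℝ) => f (z / ((t : ℝ) : ℂ)) / ((t : ℝ) : ℂ) := by
  have h : Measurable fun t : Set.Ioi (0 : ℝ) => ((t : ℝ) : ℂ) := by fun_prop
  exact (hf.measurable.comp (measurable_const.div h)).div h

theorem integrable_one_div (hm : hausdorffMass μ ≠ ∞) :
    Integrable (fun t : Set.Ioi (0 : ℝ) => 1 / (t : ℝ)) μ :=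
  (lintegral_ofReal_ne_top_iff_integrable
    (by fun_prop : Measurable fun t : Set.Ioi (0 : ℝ) => 1 / (t : ℝ)).aestronglyMeasurable
    (Eventually.of_forall fun t => one_div_nonneg.2 (le_of_lt t.2))).1 hm

theorem div_coe_mem_closedBall {z : ℂ} {R : ℝ} (hz : ‖z‖ ≤ R) {t : Set.Ioi (0 : ℝ)}
    (ht : 1 < (t : ℝ)) : z / ((t : ℝ) : ℂ) ∈ Metric.closedBall (0 : ℂ) R := by
  rw [mem_closedBall_zero_iff, norm_div, Complex.norm_real, Real.norm_eq_abs,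
    abs_of_pos (by linarith)]
  exact (div_le_self (norm_nonneg z) ht.le).trans hz

theorem integrable_hausdorff_integrand {f : ℂ → ℂ} (hf : Continuous f)
    (hμ : ∀ᵐ t : Set.Ioi (0 : ℝ) ∂μ, 1 < (t : ℝ)) (hm : hausdorffMass μ ≠ ∞) (z : ℂ) :
    Integrable (fun t : Set.Ioi (0 : ℝ) => f (z / ((t : ℝ) : ℂ)) / ((t : ℝ) : ℂ)) μ := by
  obtain ⟨B, hB⟩ := (isCompact_closedBall (0 : ℂ) ‖z‖).exists_bound_of_continuousOn hf.continuousOn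
  refine ((integrable_one_div hm).const_mul B).mono'
    (measurable_hausdorff_integrand hf z).aestronglyMeasurable ?_
  filter_upwards [hμ] with t ht
  rw [norm_div, Complex.norm_real, Real.norm_eq_abs, abs_of_pos t.2, div_eq_mul_one_div]
  exact mul_le_mul_of_nonneg_right (hB _ (div_coe_mem_closedBall le_rfl ht))
    (one_div_nonneg.2 (le_of_lt t.2))

theorem differentiable_hausdorff {f : ℂ → ℂ} (hf : Differentiable ℂ f)
    (hμ : ∀ᵐ t : Set.Ioi (0 : ℝ) ∂μ, 1 < (t : ℝ)) (hm : hausdorffMass μ ≠ ∞) :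
    Differentiable ℂ (hausdorff μ f) := by
  intro z₀
  have hf' : Continuous (deriv f) := (hf.contDiff (n := 1)).continuous_deriv le_rfl
  obtain ⟨B, hB⟩ := (isCompact_closedBall (0 : ℂ) (‖z₀‖ + 1)).exists_bound_of_continuousOn
    hf'.continuousOn
  refine (hasDerivAt_integral_of_dominated_loc_of_deriv_le (Metric.ball_mem_nhds z₀ one_pos)
    (Eventually.of_forall fun z => (measurable_hausdorff_integrand hf.continuous z).aestronglyMeasurable)
    (integrable_hausdorff_integrand hf.continuous hμ hm z₀)
    (F' := fun z (t : Set.Ioi (0 : ℝ)) => deriv f (z / ((t : ℝ) : ℂ)) * (1 / ((t : ℝ) : ℂ)) / ((t : ℝ) : ℂ))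
    (bound := fun t : Set.Ioi (0 : ℝ) => B * (1 / (t : ℝ))) ?_ ?_ ((integrable_one_div hm).const_mul B)
    ?_).2.differentiableAt
  · have h : Measurable fun t : Set.Ioi (0 : ℝ) => ((t : ℝ) : ℂ) := by fun_prop
    exact (((hf'.measurable.comp (measurable_const.div h)).mul
      (measurable_const.div h)).div h).aestronglyMeasurable
  · filter_upwards [hμ] with t ht z hz
    have hz' : ‖z‖ ≤ ‖z₀‖ + 1 := by
      have h2 : ‖z - z₀‖ < 1 := by rwa [mem_ball_iff_norm] at hz
      have := norm_le_norm_add_norm_sub' z z₀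
      linarith
    have h1 := hB _ (div_coe_mem_closedBall hz' ht)
    have ht0 : (0 : ℝ) < t := t.2
    rw [norm_div, norm_mul, norm_div, norm_one, Complex.norm_real, Real.norm_eq_abs,
      abs_of_pos ht0, div_eq_mul_one_div]
    refine mul_le_mul_of_nonneg_right ?_ (by positivity)
    have h3 : 1 / (t : ℝ) ≤ 1 := by rw [div_le_one ht0]; exact ht.le
    exact (mul_le_of_le_one_right (norm_nonneg _) h3).trans h1
  · refine Eventually.of_forall fun t z _ => ?_
    have h1 : HasDerivAt (fun z : ℂ => z / ((t : ℝ) : ℂ)) (1 / ((t : ℝ) : ℂ)) z :=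
      (hasDerivAt_id z).div_const _
    exact (((hf _).hasDerivAt).comp z h1).div_const _

theorem enorm_hausdorff_le {f : ℂ → ℂ} {z : ℂ} {B : ℝ≥0∞}
    (h : ∀ᵐ t : Set.Ioi (0 : ℝ) ∂μ, ‖f (z / ((t : ℝ) : ℂ))‖ₑ ≤ B) :
    ‖hausdorff μ f z‖ₑ ≤ B * hausdorffMass μ := by
  rw [hausdorffMass, ← lintegral_const_mul _ (by fun_prop)]
  refine (enorm_integral_le_lintegral_enorm _).trans (lintegral_mono_ae ?_)
  filter_upwards [h] with t ht
  rw [enorm_div_coe]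
  gcongr

/-- A Hausdorff operator whose measure lives on `(1, ∞)` is bounded on every Fock space, with norm
at most a constant times the mass of the measure. The pointwise radial maximal inequality replaces
Minkowski's inequality, which fails for `p < 1`. -/
theorem exists_fockENorm_hausdorff_le {p : ℝ≥0∞} (hp : 0 < p) {α : ℝ} (hα : 0 < α) :
    ∃ C : ℝ≥0∞, C ≠ ∞ ∧ ∀ μ : Measure (Set.Ioi (0 : ℝ)),
      (∀ᵐ t : Set.Ioi (0 : ℝ) ∂μ, 1 < (t : ℝ)) → ∀ f : ℂ → ℂ, Differentiable ℂ f →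
        fockENorm p α (hausdorff μ f) ≤ C * hausdorffMass μ * fockENorm p α f := by
  have hdil : ∀ (z : ℂ) (t : Set.Ioi (0 : ℝ)),
      z / ((t : ℝ) : ℂ) = ((1 / (t : ℝ) : ℝ) : ℂ) * z := fun z t => by
    push_cast; ring
  by_cases hi : p = ∞
  · subst hi
    refine ⟨1, ENNReal.one_ne_top, fun μ hμ f hf => ?_⟩
    rw [one_mul, fockENorm_top α (hausdorff μ f)]
    refine iSup_le fun z => ?_
    rw [← ENNReal.le_div_iff_mul_le (Or.inl (fockWeight_ne_zero α z))
      (Or.inl (fockWeight_ne_top α z)), mul_comm, ENNReal.mul_div_right_comm]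
    refine enorm_hausdorff_le ?_
    filter_upwards [hμ] with t ht
    rw [ENNReal.le_div_iff_mul_le (Or.inl (fockWeight_ne_zero α z))
      (Or.inl (fockWeight_ne_top α z)), fockENorm_top]
    refine le_trans ?_ (le_iSup (fun z => ‖f z‖ₑ * fockWeight α z) (z / ((t : ℝ) : ℂ)))
    refine mul_le_mul_right ?_ _
    have ht0 : (0 : ℝ) < t := t.2
    refine ENNReal.ofReal_le_ofReal (Real.exp_le_exp.2 ?_)
    have h2 := pow_le_pow_left₀ (norm_nonneg _)
      (mem_closedBall_zero_iff.1 (div_coe_mem_closedBall (le_refl ‖z‖) ht)) 2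
    nlinarith
  have hq : 0 < p.toReal := ENNReal.toReal_pos hp.ne' hi
  set q := p.toReal with hqdef
  obtain ⟨C, hC, hmax⟩ := exists_dilation_le_convolution hα hq
  set c := ENNReal.ofReal (α * q / (2 * Real.pi)) with hc
  set I := ∫⁻ z : ℂ, ENNReal.ofReal (Real.exp (-(α * q / 4) * ‖z‖ ^ 2)) with hI
  have hIt : I ≠ ∞ := lintegral_exp_neg_mul_norm_sq_ne_top (by positivity)
  refine ⟨(C * I) ^ (1 / q), ENNReal.rpow_ne_top_of_nonneg (by positivity)
    (ENNReal.mul_ne_top hC hIt), fun μ hμ f hf => ?_⟩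
  set m := hausdorffMass μ with hm
  set g : ℂ → ℝ≥0∞ := fun u => (‖f u‖ₑ * fockWeight α u) ^ q with hg
  have hgm : Measurable g := measurable_fockDensity hf.continuous α q
  set Φ : ℂ → ℝ≥0∞ := fun z => C * ∫⁻ u, g u *
    ENNReal.ofReal (Real.exp (-(α * q / 4) * ‖z - u‖ ^ 2)) with hΦ
  have hpt : ∀ z, (‖hausdorff μ f z‖ₑ * fockWeight α z) ^ q ≤ m ^ q * Φ z := by
    intro z
    have h1 : ‖hausdorff μ f z‖ₑ ≤ Φ z ^ (1 / q) / fockWeight α z * m := by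
      refine enorm_hausdorff_le ?_
      filter_upwards [hμ] with t ht
      have ht0 : (0 : ℝ) < t := t.2
      rw [ENNReal.le_div_iff_mul_le (Or.inl (fockWeight_ne_zero α z))
        (Or.inl (fockWeight_ne_top α z)), hdil, one_div q, ENNReal.le_rpow_inv_iff hq]
      exact hmax f hf _ (by positivity) (by rw [div_le_one ht0]; exact ht.le) z
    have h2 : ‖hausdorff μ f z‖ₑ * fockWeight α z ≤ m * Φ z ^ (1 / q) := by
      rw [← ENNReal.le_div_iff_mul_le (Or.inl (fockWeight_ne_zero α z))
        (Or.inl (fockWeight_ne_top α z))]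
      refine h1.trans_eq ?_
      rw [mul_comm, mul_div_assoc]
    calc _ ≤ (m * Φ z ^ (1 / q)) ^ q := ENNReal.rpow_le_rpow h2 hq.le
      _ = _ := by
        rw [ENNReal.mul_rpow_of_nonneg _ _ hq.le, ← ENNReal.rpow_mul, one_div_mul_cancel hq.ne',
          ENNReal.rpow_one]
  have hkm : Measurable fun x : ℂ × ℂ =>
      ENNReal.ofReal (Real.exp (-(α * q / 4) * ‖x.1 - x.2‖ ^ 2)) := by fun_prop
  have hΦint : ∫⁻ z, Φ z = C * I * ∫⁻ u, g u := by
    rw [hΦ, lintegral_const_mul' _ _ hC, lintegral_lintegral_swap, mul_assoc]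
    · congr 1
      rw [← lintegral_const_mul' _ _ hIt]
      refine lintegral_congr fun u => ?_
      rw [lintegral_const_mul, mul_comm, hI,
        lintegral_sub_right_eq_self
          (fun z => ENNReal.ofReal (Real.exp (-(α * q / 4) * ‖z‖ ^ 2))) u]
      fun_prop
    · exact ((hgm.comp measurable_snd).mul hkm).aemeasurable
  have hΦm : Measurable Φ := by
    refine Measurable.const_mul ?_ _
    exact Measurable.lintegral_prod_right ((hgm.comp measurable_snd).mul hkm)
  rw [fockENorm_of_ne_top hi, fockENorm_of_ne_top hi, ← hqdef, ← hc]
  have h3 : c * ∫⁻ z, (‖hausdorff μ f z‖ₑ * fockWeight α z) ^ q ≤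
      (C * I) * m ^ q * (c * ∫⁻ u, g u) := by
    calc _ ≤ c * ∫⁻ z, m ^ q * Φ z := by gcongr with z; exact hpt z
      _ = c * (m ^ q * (C * I * ∫⁻ u, g u)) := by
        rw [lintegral_const_mul _ hΦm, hΦint]
      _ = _ := by ring
  refine (ENNReal.rpow_le_rpow h3 (by positivity : 0 ≤ 1 / q)).trans_eq ?_
  rw [ENNReal.mul_rpow_of_nonneg _ _ (by positivity), ENNReal.mul_rpow_of_nonneg _ _ (by positivity),
    ← ENNReal.rpow_mul, mul_one_div_cancel hq.ne', ENNReal.rpow_one]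

end Hausdorff

/-! ### Norm convergence of Hausdorff operators along locally uniformly convergent sequences -/

section Hausdorff

variable {μ : Measure (Set.Ioi (0 : ℝ))}

theorem hausdorffMass_restrict_eq (s : Set (Set.Ioi (0 : ℝ))) (hs : MeasurableSet s) :
    hausdorffMass (μ.restrict s) =
      μ.withDensity (fun t => ENNReal.ofReal (1 / (t : ℝ))) s := by
  rw [hausdorffMass, withDensity_apply _ hs]

theorem hausdorffMass_restrict_le (s : Set (Set.Ioi (0 : ℝ))) :
    hausdorffMass (μ.restrict s) ≤ hausdorffMass μ :=
  lintegral_mono' Measure.restrict_le_self le_rfl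

theorem measurableSet_coe_le (a : ℝ) : MeasurableSet {t : Set.Ioi (0 : ℝ) | (t : ℝ) ≤ a} :=
  measurableSet_le measurable_subtype_coe measurable_const

/-- A measure on `(1, ∞)` has little mass close to `1`. -/
theorem tendsto_hausdorffMass_restrict (hμ : ∀ᵐ t : Set.Ioi (0 : ℝ) ∂μ, 1 < (t : ℝ))
    (hm : hausdorffMass μ ≠ ∞) :
    Tendsto (fun n : ℕ => hausdorffMass
      (μ.restrict {t : Set.Ioi (0 : ℝ) | (t : ℝ) ≤ 1 + 1 / ((n : ℝ) + 1)})) atTop (𝓝 0) := by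
  set ν := μ.withDensity (fun t : Set.Ioi (0 : ℝ) => ENNReal.ofReal (1 / (t : ℝ))) with hν
  set s : ℕ → Set (Set.Ioi (0 : ℝ)) := fun n => {t | (t : ℝ) ≤ 1 + 1 / ((n : ℝ) + 1)} with hs
  have hanti : Antitone s := by
    intro m n hmn t ht
    refine le_trans (show (t : ℝ) ≤ 1 + 1 / ((n : ℝ) + 1) from ht) ?_
    gcongr
  have hfin : ν (s 0) ≠ ∞ := by
    rw [← hausdorffMass_restrict_eq _ (measurableSet_coe_le _)]
    exact ne_top_of_le_ne_top hm (hausdorffMass_restrict_le _)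
  have hlim := tendsto_measure_iInter_atTop (μ := ν)
    (fun n => (measurableSet_coe_le _ : MeasurableSet (s n)).nullMeasurableSet) hanti ⟨0, hfin⟩
  have hinter : (⋂ n, s n) ⊆ {t : Set.Ioi (0 : ℝ) | ¬ 1 < (t : ℝ)} := by
    intro t ht h1
    obtain ⟨n, hn⟩ := exists_nat_one_div_lt (sub_pos.2 h1)
    have : (t : ℝ) ≤ 1 + 1 / ((n : ℝ) + 1) := Set.mem_iInter.1 ht n
    linarith
  have h0 : ν (⋂ n, s n) = 0 :=
    measure_mono_null hinter ((withDensity_absolutelyContinuous μ _).ae_le hμ)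
  rw [h0] at hlim
  refine hlim.congr fun n => ?_
  rw [Function.comp_apply, hausdorffMass_restrict_eq _ (measurableSet_coe_le _)]

theorem hausdorff_restrict_add_compl {f : ℂ → ℂ} (hf : Continuous f)
    (hμ : ∀ᵐ t : Set.Ioi (0 : ℝ) ∂μ, 1 < (t : ℝ)) (hm : hausdorffMass μ ≠ ∞)
    {s : Set (Set.Ioi (0 : ℝ))} (hs : MeasurableSet s) :
    hausdorff μ f = hausdorff (μ.restrict s) f + hausdorff (μ.restrict sᶜ) f :=
  funext fun z => (integral_add_compl hs (integrable_hausdorff_integrand hf hμ hm z)).symm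

/-- If the measure lives on `(1 + δ, ∞)`, then the Hausdorff operator improves the Gaussian growth
of a function. -/
theorem enorm_hausdorff_le_of_far {α δ : ℝ} (hα : 0 < α) (hδ : 0 < δ)
    (hμ : ∀ᵐ t : Set.Ioi (0 : ℝ) ∂μ, 1 + δ < (t : ℝ)) {f : ℂ → ℂ} {ε : ℝ} (hε : 0 ≤ ε)
    (hf : ∀ w, ‖f w‖ ≤ ε * Real.exp (α / 2 * (1 + δ) * ‖w‖ ^ 2)) (z : ℂ) :
    ‖hausdorff μ f z‖ₑ ≤
      ENNReal.ofReal (ε * Real.exp (α / (2 * (1 + δ)) * ‖z‖ ^ 2)) * hausdorffMass μ := by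
  refine enorm_hausdorff_le ?_
  filter_upwards [hμ] with t ht
  rw [← ofReal_norm]
  refine ENNReal.ofReal_le_ofReal ((hf _).trans ?_)
  refine mul_le_mul_of_nonneg_left (Real.exp_le_exp.2 ?_) hε
  have ht0 : (0 : ℝ) < t := t.2
  rw [norm_div, Complex.norm_real, Real.norm_eq_abs, abs_of_pos ht0, div_pow]
  have h1 : 0 < 1 + δ := by linarith
  have h2 : (1 + δ) * (‖z‖ ^ 2 / (t : ℝ) ^ 2) ≤ 1 / (1 + δ) * ‖z‖ ^ 2 := by
    have h3 : (1 + δ) / (t : ℝ) ^ 2 ≤ 1 / (1 + δ) := by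
      rw [div_le_div_iff₀ (by positivity) h1]
      nlinarith
    calc _ = (1 + δ) / (t : ℝ) ^ 2 * ‖z‖ ^ 2 := by ring
      _ ≤ _ := by gcongr
  calc _ = α / 2 * ((1 + δ) * (‖z‖ ^ 2 / (t : ℝ) ^ 2)) := by ring
    _ ≤ α / 2 * (1 / (1 + δ) * ‖z‖ ^ 2) := by gcongr
    _ = _ := by field_simp

/-- For a sequence bounded in a Fock space, locally uniform convergence to `0` is uniform with
respect to every Gaussian weight of larger exponent. -/
theorem eventually_norm_le_of_tendstoLocallyUniformly {α δ B : ℝ} (hα : 0 < α) (hδ : 0 < δ)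
    {h : ℕ → ℂ → ℂ} (hB : ∀ n z, ‖h n z‖ ≤ B * Real.exp (α / 2 * ‖z‖ ^ 2))
    (hlim : TendstoLocallyUniformly h 0 atTop) {ε : ℝ} (hε : 0 < ε) :
    ∀ᶠ n in atTop, ∀ w, ‖h n w‖ ≤ ε * Real.exp (α / 2 * (1 + δ) * ‖w‖ ^ 2) := by
  have hB0 : 0 ≤ B := by
    have := (norm_nonneg _).trans (hB 0 0)
    simpa using this
  have htend : Tendsto (fun R : ℝ => ε * Real.exp (α / 2 * δ * R ^ 2)) atTop atTop := by
    refine Tendsto.const_mul_atTop hε (Real.tendsto_exp_atTop.comp ?_)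
    exact Tendsto.const_mul_atTop (by positivity) (tendsto_pow_atTop two_ne_zero)
  obtain ⟨R, hRB, hR0⟩ := ((htend.eventually_ge_atTop B).and (eventually_ge_atTop 0)).exists
  have hK := (tendstoLocallyUniformly_iff_forall_isCompact.1 hlim) _
    (isCompact_closedBall (0 : ℂ) R)
  filter_upwards [Metric.tendstoUniformlyOn_iff.1 hK ε hε] with n hn w
  rcases le_total ‖w‖ R with hw | hw
  · have h1 := hn w (mem_closedBall_zero_iff.2 hw)
    rw [Pi.zero_apply, dist_zero_left] at h1
    refine h1.le.trans (le_mul_of_one_le_right hε.le (Real.one_le_exp ?_))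
    positivity
  · refine (hB n w).trans ?_
    have h1 : Real.exp (α / 2 * δ * R ^ 2) ≤ Real.exp (α / 2 * δ * ‖w‖ ^ 2) := by gcongr
    have h2 : B ≤ ε * Real.exp (α / 2 * δ * ‖w‖ ^ 2) := hRB.trans (by gcongr)
    calc _ ≤ ε * Real.exp (α / 2 * δ * ‖w‖ ^ 2) * Real.exp (α / 2 * ‖w‖ ^ 2) := by gcongr
      _ = _ := by rw [mul_assoc, ← Real.exp_add]; congr 2; ring

theorem exists_norm_le_of_fockENorm_le {α : ℝ} (hα : 0 < α) {p : ℝ≥0∞} (hp : 0 < p) {M : ℝ≥0∞}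
    (hM : M ≠ ∞) : ∃ B : ℝ, ∀ f : ℂ → ℂ, Differentiable ℂ f → fockENorm p α f ≤ M →
      ∀ z, ‖f z‖ ≤ B * Real.exp (α / 2 * ‖z‖ ^ 2) := by
  obtain ⟨C, hC, h⟩ := exists_enorm_mul_fockWeight_le hα p hp
  refine ⟨(C * M).toReal, fun f hf hfM z => ?_⟩
  have h1 : ‖f z‖ₑ * fockWeight α z ≤ C * M := (h f hf z).trans (by gcongr)
  have h2 := ENNReal.toReal_mono (ENNReal.mul_ne_top hC hM) h1
  rw [ENNReal.toReal_mul, fockWeight, ENNReal.toReal_ofReal (Real.exp_pos _).le,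
    toReal_enorm] at h2
  calc ‖f z‖ = ‖f z‖ * Real.exp (-(α / 2) * ‖z‖ ^ 2) * Real.exp (α / 2 * ‖z‖ ^ 2) := by
        rw [mul_assoc, ← Real.exp_add]; simp
    _ ≤ _ := by gcongr

/-- If the measure lives on `(1, ∞)`, the Hausdorff operator maps bounded sequences that converge
locally uniformly to `0` to sequences that converge to `0` in norm. -/
theorem tendsto_fockENorm_hausdorff {α : ℝ} (hα : 0 < α) {p : ℝ≥0∞} [hp : Fact (0 < p)]
    (hμ : ∀ᵐ t : Set.Ioi (0 : ℝ) ∂μ, 1 < (t : ℝ)) (hm : hausdorffMass μ ≠ ∞)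
    {h : ℕ → ℂ → ℂ} (hd : ∀ n, Differentiable ℂ (h n)) {M : ℝ≥0∞} (hM : M ≠ ∞)
    (hh : ∀ n, fockENorm p α (h n) ≤ M) (hlim : TendstoLocallyUniformly h 0 atTop) :
    Tendsto (fun n => fockENorm p α (hausdorff μ (h n))) atTop (𝓝 0) := by
  set r := (min p 1).toReal with hr
  have hr0 : 0 < r := toReal_min_one_pos p
  suffices hs : Tendsto (fun n => fockENorm p α (hausdorff μ (h n)) ^ r) atTop (𝓝 0) by
    have := hs.ennrpow_const (1 / r)
    rw [ENNReal.zero_rpow_of_pos (by positivity)] at this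
    refine this.congr fun n => ?_
    rw [← ENNReal.rpow_mul, mul_one_div_cancel hr0.ne', ENNReal.rpow_one]
  obtain ⟨C, hC, hbdd⟩ := exists_fockENorm_hausdorff_le hp.out hα
  rw [ENNReal.tendsto_nhds_zero]
  intro ε hε
  have hε2 : 0 < ε / 2 := ENNReal.half_pos hε.ne'
  -- The part of the measure close to `1` is handled by its small mass.
  obtain ⟨k, hk⟩ : ∃ k : ℕ, (C * hausdorffMass (μ.restrict
      {t : Set.Ioi (0 : ℝ) | (t : ℝ) ≤ 1 + 1 / ((k : ℝ) + 1)}) * M) ^ r ≤ ε / 2 := by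
    have h1 := ((ENNReal.Tendsto.mul_const (ENNReal.Tendsto.const_mul
      (tendsto_hausdorffMass_restrict hμ hm) (Or.inr hC)) (Or.inr hM)).ennrpow_const r :
        Tendsto _ atTop (𝓝 ((C * 0 * M) ^ r)))
    rw [mul_zero, zero_mul, ENNReal.zero_rpow_of_pos hr0] at h1
    exact (ENNReal.tendsto_nhds_zero.1 h1 _ hε2).exists
  set δ : ℝ := 1 / ((k : ℝ) + 1) with hδdef
  have hδ : 0 < δ := by positivity
  set s : Set (Set.Ioi (0 : ℝ)) := {t | (t : ℝ) ≤ 1 + δ} with hsdef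
  have hsm : MeasurableSet s := measurableSet_coe_le _
  have hμ1 : ∀ᵐ t : Set.Ioi (0 : ℝ) ∂(μ.restrict s), 1 < (t : ℝ) := ae_restrict_of_ae hμ
  have hμ2 : ∀ᵐ t : Set.Ioi (0 : ℝ) ∂(μ.restrict sᶜ), 1 < (t : ℝ) := ae_restrict_of_ae hμ
  have hμ2' : ∀ᵐ t : Set.Ioi (0 : ℝ) ∂(μ.restrict sᶜ), 1 + δ < (t : ℝ) := by
    filter_upwards [ae_restrict_mem hsm.compl] with t ht
    exact not_le.1 ht
  have hm1 := ne_top_of_le_ne_top hm (hausdorffMass_restrict_le (μ := μ) s)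
  have hm2 := ne_top_of_le_ne_top hm (hausdorffMass_restrict_le (μ := μ) sᶜ)
  set b : ℝ := α / (2 * (1 + δ)) with hb
  have hbα : b < α / 2 := by
    rw [hb, div_lt_div_iff₀ (by positivity) two_pos]
    nlinarith
  set G : ℂ → ℂ := fun z => (Real.exp (b * ‖z‖ ^ 2) : ℂ) with hG
  set K := fockENorm p α G with hK
  have hKt : K ≠ ∞ := fockENorm_exp_mul_norm_sq_ne_top hbα hp.out
  set m := hausdorffMass (μ.restrict sᶜ) with hmdef
  -- The remaining part is handled by the gain in Gaussian growth.
  obtain ⟨η, hη, hηε⟩ : ∃ η : ℝ, 0 < η ∧ (ENNReal.ofReal η * (m * K)) ^ r ≤ ε / 2 := by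
    have h1 : Tendsto (fun n : ℕ => (ENNReal.ofReal (1 / ((n : ℝ) + 1)) * (m * K)) ^ r) atTop
        (𝓝 ((ENNReal.ofReal 0 * (m * K)) ^ r)) :=
      (ENNReal.Tendsto.mul_const (ENNReal.tendsto_ofReal tendsto_one_div_add_atTop_nhds_zero_nat)
        (Or.inr (ENNReal.mul_ne_top hm2 hKt))).ennrpow_const r
    rw [ENNReal.ofReal_zero, zero_mul, ENNReal.zero_rpow_of_pos hr0] at h1
    obtain ⟨n, hn⟩ := (ENNReal.tendsto_nhds_zero.1 h1 _ hε2).exists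
    exact ⟨_, by positivity, hn⟩
  obtain ⟨B, hB⟩ := exists_norm_le_of_fockENorm_le hα hp.out hM
  filter_upwards [eventually_norm_le_of_tendstoLocallyUniformly hα hδ
    (fun n z => hB (h n) (hd n) (hh n) z) hlim hη] with n hn
  have hnear : fockENorm p α (hausdorff (μ.restrict s) (h n)) ^ r ≤ ε / 2 := by
    refine le_trans (ENNReal.rpow_le_rpow ?_ hr0.le) hk
    exact (hbdd _ hμ1 _ (hd n)).trans (by gcongr; exact hh n)
  have hfar : fockENorm p α (hausdorff (μ.restrict sᶜ) (h n)) ^ r ≤ ε / 2 := by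
    refine le_trans (ENNReal.rpow_le_rpow ?_ hr0.le) hηε
    have h1 : ∀ z, ‖hausdorff (μ.restrict sᶜ) (h n) z‖ₑ ≤
        ‖((((ENNReal.ofReal η * m).toReal : ℝ) : ℂ) • G) z‖ₑ := by
      intro z
      refine (enorm_hausdorff_le_of_far hα hδ hμ2' hη.le hn z).trans_eq ?_
      rw [Pi.smul_apply, enorm_smul, ← ofReal_norm, ← ofReal_norm (G z), Complex.norm_real,
        Complex.norm_real, Real.norm_eq_abs, Real.norm_eq_abs, abs_of_nonneg ENNReal.toReal_nonneg,
        abs_of_pos (Real.exp_pos _),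
        ENNReal.ofReal_toReal (ENNReal.mul_ne_top ENNReal.ofReal_ne_top hm2),
        ENNReal.ofReal_mul hη.le]
      ring
    refine (fockENorm_le_of_enorm_le h1).trans_eq ?_
    rw [fockENorm_const_smul, ← ofReal_norm, Complex.norm_real, Real.norm_eq_abs,
      abs_of_nonneg ENNReal.toReal_nonneg,
      ENNReal.ofReal_toReal (ENNReal.mul_ne_top ENNReal.ofReal_ne_top hm2), mul_assoc]
  rw [hausdorff_restrict_add_compl (hd n).continuous hμ hm hsm]
  refine (fockENorm_add_le p α (differentiable_hausdorff (hd n) hμ1 hm1).continuous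
    (differentiable_hausdorff (hd n) hμ2 hm2).continuous).trans ?_
  exact (add_le_add hnear hfar).trans_eq (ENNReal.add_halves ε)

end Hausdorff

/-! ### The topology of the Fock space and compactness -/

namespace FockSpace

variable {p : ℝ≥0∞} [hp : Fact (0 < p)] {α : ℝ}

theorem ext_toFun {f g : FockSpace p α} (h : ∀ z, f z = g z) : f = g :=
  Subtype.ext (funext h)

theorem differentiable (f : FockSpace p α) : Differentiable ℂ f := f.2.1

theorem fockENorm_lt_top (f : FockSpace p α) : fockENorm p α f < ∞ := f.2.2

theorem toFun_sub (f g : FockSpace p α) : (f - g).toFun = f.toFun - g.toFun := rfl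

theorem toFun_smul (c : ℂ) (f : FockSpace p α) : (c • f).toFun = c • f.toFun := rfl

theorem dist_eq [Fact (0 < α)] (f g : FockSpace p α) :
    dist f g = (fockENorm p α (f.toFun - g.toFun)).toReal ^ (min p 1).toReal := rfl

theorem mem_closedBall_zero_one_iff [Fact (0 < α)] (f : FockSpace p α) :
    f ∈ Metric.closedBall (0 : FockSpace p α) 1 ↔ fockENorm p α f ≤ 1 := by
  have h0 : f.toFun - (0 : FockSpace p α).toFun = f.toFun := sub_zero _
  have hr := toReal_min_one_pos p
  rw [Metric.mem_closedBall, dist_eq, h0, ← Real.one_rpow (min p 1).toReal,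
    Real.rpow_le_rpow_iff ENNReal.toReal_nonneg zero_le_one hr, ← ENNReal.toReal_one,
    ENNReal.toReal_le_toReal f.fockENorm_lt_top.ne ENNReal.one_ne_top]

theorem tendsto_of_tendsto_fockENorm [Fact (0 < α)] {f : ℕ → FockSpace p α} {g : FockSpace p α}
    (h : Tendsto (fun n => fockENorm p α ((f n).toFun - g.toFun)) atTop (𝓝 0)) :
    Tendsto f atTop (𝓝 g) := by
  rw [tendsto_iff_dist_tendsto_zero]
  have h1 := (ENNReal.tendsto_toReal ENNReal.zero_ne_top).comp h
  have h2 := h1.rpow_const (p := (min p 1).toReal) (Or.inr (toReal_min_one_pos p).le)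
  rwa [ENNReal.toReal_zero, Real.zero_rpow (toReal_min_one_pos p).ne'] at h2

theorem tendsto_fockENorm_of_tendsto [Fact (0 < α)] {f : ℕ → FockSpace p α} {g : FockSpace p α}
    (h : Tendsto f atTop (𝓝 g)) :
    Tendsto (fun n => fockENorm p α ((f n).toFun - g.toFun)) atTop (𝓝 0) := by
  rw [tendsto_iff_dist_tendsto_zero] at h
  have hr := toReal_min_one_pos p
  have h1 := h.rpow_const (p := 1 / (min p 1).toReal) (Or.inr (by positivity))
  rw [Real.zero_rpow (by positivity)] at h1
  have h2 := ENNReal.tendsto_ofReal h1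
  rw [ENNReal.ofReal_zero] at h2
  refine h2.congr fun n => ?_
  rw [dist_eq, ← Real.rpow_mul ENNReal.toReal_nonneg, mul_one_div_cancel hr.ne', Real.rpow_one]
  exact ENNReal.ofReal_toReal (fockENorm_lt_top (f n - g)).ne

end FockSpace

/-- The Hausdorff operator of a finite measure on `(1, ∞)`, as a linear map of a Fock space. -/
noncomputable def hausdorffFock (p : ℝ≥0∞) [hp : Fact (0 < p)] (α : ℝ) [hα : Fact (0 < α)]
    {μ : Measure (Set.Ioi (0 : ℝ))} (hμ : ∀ᵐ t : Set.Ioi (0 : ℝ) ∂μ, 1 < (t : ℝ))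
    (hm : hausdorffMass μ ≠ ∞) : FockSpace p α →ₗ[ℂ] FockSpace p α where
  toFun f := ⟨hausdorff μ f, differentiable_hausdorff f.differentiable hμ hm, by
    obtain ⟨C, hC, h⟩ := exists_fockENorm_hausdorff_le hp.out hα.out
    exact (h μ hμ f f.differentiable).trans_lt
      (ENNReal.mul_lt_top (ENNReal.mul_lt_top hC.lt_top hm.lt_top) f.fockENorm_lt_top)⟩
  map_add' f g := FockSpace.ext_toFun fun z => by
    have h := integral_add
      (integrable_hausdorff_integrand f.differentiable.continuous hμ hm z)
      (integrable_hausdorff_integrand g.differentiable.continuous hμ hm z)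
    simp only [← add_div] at h
    exact h
  map_smul' c f := FockSpace.ext_toFun fun z => by
    have h := integral_const_mul (μ := μ) c
      (fun t : Set.Ioi (0 : ℝ) => f (z / ((t : ℝ) : ℂ)) / ((t : ℝ) : ℂ))
    simp only [← mul_div_assoc] at h
    exact h

theorem hausdorffFock_toFun {p : ℝ≥0∞} [hp : Fact (0 < p)] {α : ℝ} [hα : Fact (0 < α)]
    {μ : Measure (Set.Ioi (0 : ℝ))} (hμ : ∀ᵐ t : Set.Ioi (0 : ℝ) ∂μ, 1 < (t : ℝ))
    (hm : hausdorffMass μ ≠ ∞) (f : FockSpace p α) :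
    (hausdorffFock p α hμ hm f).toFun = hausdorff μ f := rfl

/-- The image of the closed unit ball is itself compact: by Montel's theorem and Fatou's lemma, bounded
sequences have subsequences that converge locally uniformly to an element of the ball. -/
theorem isCompactOperator_hausdorffFock (p : ℝ≥0∞) [hp : Fact (0 < p)] (α : ℝ) [hα : Fact (0 < α)]
    {μ : Measure (Set.Ioi (0 : ℝ))} (hμ : ∀ᵐ t : Set.Ioi (0 : ℝ) ∂μ, 1 < (t : ℝ))
    (hm : hausdorffMass μ ≠ ∞) : IsCompactOperator (hausdorffFock p α hμ hm) := by
  refine ⟨hausdorffFock p α hμ hm '' Metric.closedBall 0 1, IsSeqCompact.isCompact ?_,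
    mem_of_superset (Metric.closedBall_mem_nhds _ one_pos) (Set.subset_preimage_image _ _)⟩
  intro x hx
  choose f hf hfx using hx
  have hf1 : ∀ n, fockENorm p α (f n) ≤ 1 := fun n =>
    (FockSpace.mem_closedBall_zero_one_iff _).1 (hf n)
  obtain ⟨B, hB⟩ := exists_norm_le_of_fockENorm_le hα.out hp.out ENNReal.one_ne_top
  have hα0 := hα.out
  obtain ⟨g, φ, hg, hφ, hlim⟩ := exists_subseq_tendstoLocallyUniformly
    (f := fun n => (f n).toFun) (fun n => (f n).differentiable) fun R => by
      refine ⟨B * Real.exp (α / 2 * R ^ 2), fun n z hz => ?_⟩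
      have hB0 : 0 ≤ B := by
        have := (norm_nonneg _).trans (hB _ (f 0).differentiable (hf1 0) 0)
        simpa using this
      refine (hB _ (f n).differentiable (hf1 n) z).trans ?_
      have := mem_closedBall_zero_iff.1 hz
      gcongr
  have hg1 : fockENorm p α g ≤ 1 :=
    fockENorm_le_of_tendsto hp.out hα.out (fun n => (f (φ n)).differentiable.continuous)
      (fun z => (tendstoLocallyUniformlyOn_univ.2 hlim).tendsto_at (Set.mem_univ z)) fun n => hf1 (φ n)
  set G : FockSpace p α := ⟨g, hg, hg1.trans_lt ENNReal.one_lt_top⟩ with hG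
  refine ⟨hausdorffFock p α hμ hm G, ⟨G, (FockSpace.mem_closedBall_zero_one_iff _).2 hg1, rfl⟩,
    φ, hφ, ?_⟩
  refine FockSpace.tendsto_of_tendsto_fockENorm ?_
  have hr := toReal_min_one_pos p
  have hlim0 : TendstoLocallyUniformly (fun n => (f (φ n) - G).toFun) 0 atTop := by
    rw [Metric.tendstoLocallyUniformly_iff] at hlim ⊢
    intro ε hε z
    obtain ⟨t, ht, h⟩ := hlim ε hε z
    refine ⟨t, ht, h.mono fun n hn w hw => ?_⟩
    rw [Pi.zero_apply, dist_zero_left, FockSpace.toFun_sub, Pi.sub_apply, ← dist_eq_norm, dist_comm]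
    exact hn w hw
  have hbdd : ∀ n, fockENorm p α (f (φ n) - G).toFun ≤ 2 ^ (1 / (min p 1).toReal) := fun n => by
    rw [one_div, ENNReal.le_rpow_inv_iff hr, FockSpace.toFun_sub, sub_eq_add_neg]
    refine (fockENorm_add_le p α (f (φ n)).differentiable.continuous hg.neg.continuous).trans ?_
    rw [fockENorm_neg, ← one_add_one_eq_two]
    exact add_le_add (ENNReal.rpow_le_one (hf1 _) hr.le) (ENNReal.rpow_le_one hg1 hr.le)
  refine (tendsto_fockENorm_hausdorff hα.out hμ hm (fun n => (f (φ n) - G).differentiable)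
    (ENNReal.rpow_ne_top_of_nonneg (by positivity) ENNReal.ofNat_ne_top) hbdd hlim0).congr
    fun n => ?_
  rw [Function.comp_apply, ← hfx, ← FockSpace.toFun_sub, ← map_sub, hausdorffFock_toFun]

theorem isCompactHausdorff_of_ae_one_lt (p : ℝ≥0∞) [Fact (0 < p)] (α : ℝ) [Fact (0 < α)]
    {μ : Measure (Set.Ioi (0 : ℝ))} (hμ : ∀ᵐ t : Set.Ioi (0 : ℝ) ∂μ, 1 < (t : ℝ))
    (hm : hausdorffMass μ ≠ ∞) : IsCompactHausdorff μ p p α :=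
  ⟨hausdorffFock p α hμ hm,
    fun f z => ⟨integrable_hausdorff_integrand f.differentiable.continuous hμ hm z, rfl⟩,
    isCompactOperator_hausdorffFock p α hμ hm⟩

/-! ### Kernels and the necessity of the condition on the measure -/

/-- The Weyl translate `e^{α a z - α a²/2}` of the constant function `1` by a real number `a`; it is
the normalized reproducing kernel at `a` of the Fock space with `p = 2`. -/
noncomputable def fockKernel (α a : ℝ) (z : ℂ) : ℂ :=
  Complex.exp (((α * a : ℝ) : ℂ) * z - ((α / 2 * a ^ 2 : ℝ) : ℂ))

theorem differentiable_fockKernel (α a : ℝ) : Differentiable ℂ (fockKernel α a) := by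
  unfold fockKernel; fun_prop

theorem norm_fockKernel (α a : ℝ) (z : ℂ) :
    ‖fockKernel α a z‖ = Real.exp (α * a * z.re - α / 2 * a ^ 2) := by
  rw [fockKernel, Complex.norm_exp, Complex.sub_re, Complex.re_ofReal_mul, Complex.ofReal_re]

theorem fockKernel_ofReal (α a x : ℝ) :
    fockKernel α a (x : ℂ) = ((Real.exp (α * a * x - α / 2 * a ^ 2) : ℝ) : ℂ) := by
  rw [fockKernel]; push_cast; rfl

theorem enorm_fockKernel_mul_fockWeight (α a : ℝ) (z : ℂ) :
    ‖fockKernel α a z‖ₑ * fockWeight α z = fockWeight α (z - (a : ℂ)) := by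
  rw [← ofReal_norm, norm_fockKernel, fockWeight, fockWeight,
    ← ENNReal.ofReal_mul (Real.exp_pos _).le, ← Real.exp_add]
  congr 2
  rw [← Complex.normSq_eq_norm_sq, ← Complex.normSq_eq_norm_sq, Complex.normSq_apply,
    Complex.normSq_apply, Complex.sub_re, Complex.sub_im, Complex.ofReal_re, Complex.ofReal_im]
  ring

theorem fockENorm_fockKernel (p : ℝ≥0∞) (α a : ℝ) :
    fockENorm p α (fockKernel α a) = fockENorm p α 1 := by
  by_cases hi : p = ∞
  · subst hi
    simp only [fockENorm_top, enorm_fockKernel_mul_fockWeight, Pi.one_apply, enorm_one, one_mul]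
    exact (Equiv.subRight (a : ℂ)).iSup_comp (g := fockWeight α)
  · simp only [fockENorm_of_ne_top hi, enorm_fockKernel_mul_fockWeight, Pi.one_apply, enorm_one,
      one_mul]
    rw [lintegral_sub_right_eq_self (fun z => fockWeight α z ^ p.toReal)]

theorem fockENorm_one_ne_top {p : ℝ≥0∞} (hp : 0 < p) {α : ℝ} (hα : 0 < α) :
    fockENorm p α 1 ≠ ∞ := by
  refine ne_top_of_le_ne_top
    (fockENorm_exp_mul_norm_sq_ne_top (b := 0) (by positivity : (0 : ℝ) < α / 2) hp)
    (fockENorm_le_of_enorm_le fun z => ?_)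
  simp

section Necessity

variable {μ : Measure (Set.Ioi (0 : ℝ))} {α : ℝ} {p : ℝ≥0∞}

/-- Testing absolute convergence on `e^{α z²/4}` forces the measure to decay at `0`. -/
theorem integrable_exp_of_integrable [hp : Fact (0 < p)] (hα : 0 < α)
    (h : ∀ (f : FockSpace p α) (z : ℂ),
      Integrable (fun t : Set.Ioi (0 : ℝ) => f (z / ((t : ℝ) : ℂ)) / ((t : ℝ) : ℂ)) μ) (R : ℝ) :
    Integrable (fun t : Set.Ioi (0 : ℝ) => Real.exp (α * (R / (t : ℝ)) ^ 2) / (t : ℝ)) μ := by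
  set g : ℂ → ℂ := fun z => Complex.exp (((α / 4 : ℝ) : ℂ) * z ^ 2) with hg
  have hgd : Differentiable ℂ g := by rw [hg]; fun_prop
  have hgn : fockENorm p α g < ∞ := by
    refine lt_of_le_of_lt (fockENorm_le_of_enorm_le fun z => ?_)
      (fockENorm_exp_mul_norm_sq_ne_top (b := α / 4) (by linarith) hp.out).lt_top
    rw [← ofReal_norm, ← ofReal_norm, Complex.norm_real, Real.norm_eq_abs,
      abs_of_pos (Real.exp_pos _), hg, Complex.norm_exp, Complex.re_ofReal_mul]
    refine ENNReal.ofReal_le_ofReal (Real.exp_le_exp.2 ?_)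
    have : (z ^ 2).re ≤ ‖z‖ ^ 2 := (Complex.re_le_norm _).trans_eq (norm_pow z 2)
    gcongr
  refine (h ⟨g, hgd, hgn⟩ ((2 * R : ℝ) : ℂ)).norm.congr (Eventually.of_forall fun t => ?_)
  have ht0 : (0 : ℝ) < t := t.2
  change ‖g _ / _‖ = _
  rw [norm_div, Complex.norm_real, Real.norm_eq_abs, abs_of_pos ht0, hg]
  dsimp only
  rw [← Complex.ofReal_div, ← Complex.ofReal_pow, ← Complex.ofReal_mul, Complex.norm_exp_ofReal]
  congr 2
  ring

theorem norm_hausdorff_fockKernel_le (hα : 0 < α) (z : ℂ)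
    (hint : Integrable
      (fun t : Set.Ioi (0 : ℝ) => Real.exp (α * (‖z‖ / (t : ℝ)) ^ 2) / (t : ℝ)) μ) (a : ℝ) :
    ‖hausdorff μ (fockKernel α a) z‖ ≤ Real.exp (-(α / 4) * a ^ 2) *
      ∫ t : Set.Ioi (0 : ℝ), Real.exp (α * (‖z‖ / (t : ℝ)) ^ 2) / (t : ℝ) ∂μ := by
  rw [← integral_const_mul]
  refine norm_integral_le_of_norm_le (hint.const_mul _) (Eventually.of_forall fun t => ?_)
  have ht0 : (0 : ℝ) < t := t.2
  rw [norm_div, Complex.norm_real, Real.norm_eq_abs, abs_of_pos ht0, norm_fockKernel, ← mul_div_assoc,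
    ← Real.exp_add]
  refine div_le_div_of_nonneg_right (Real.exp_le_exp.2 ?_) ht0.le
  have h1 : |(z / ((t : ℝ) : ℂ)).re| ≤ ‖z‖ / (t : ℝ) := by
    refine (Complex.abs_re_le_norm _).trans_eq ?_
    rw [norm_div, Complex.norm_real, Real.norm_eq_abs, abs_of_pos ht0]
  have h2 : a * (z / ((t : ℝ) : ℂ)).re ≤ a ^ 2 / 4 + (‖z‖ / (t : ℝ)) ^ 2 := by
    have h3 : (z / ((t : ℝ) : ℂ)).re ^ 2 ≤ (‖z‖ / (t : ℝ)) ^ 2 := by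
      rw [← sq_abs]; gcongr
    nlinarith [sq_nonneg (a / 2 - (z / ((t : ℝ) : ℂ)).re)]
  nlinarith [mul_le_mul_of_nonneg_left h2 hα.le]

/-- At the point `a`, where the kernel peaks, the dilations by `t ≤ 1` do not decrease it. -/
theorem hausdorffMass_restrict_le_enorm_hausdorff_fockKernel (hα : 0 < α) (a : ℝ)
    (hint : Integrable (fun t : Set.Ioi (0 : ℝ) =>
      fockKernel α a ((a : ℂ) / ((t : ℝ) : ℂ)) / ((t : ℝ) : ℂ)) μ) :
    hausdorffMass (μ.restrict {t : Set.Ioi (0 : ℝ) | (t : ℝ) ≤ 1}) ≤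
      ‖hausdorff μ (fockKernel α a) (a : ℂ)‖ₑ * fockWeight α (a : ℂ) := by
  set φ : Set.Ioi (0 : ℝ) → ℝ :=
    fun t => Real.exp (α * a * (a / (t : ℝ)) - α / 2 * a ^ 2) / (t : ℝ) with hφ
  have hφ0 : ∀ t, 0 ≤ φ t := fun t => div_nonneg (Real.exp_pos _).le (le_of_lt t.2)
  have heq : ∀ t : Set.Ioi (0 : ℝ),
      fockKernel α a ((a : ℂ) / ((t : ℝ) : ℂ)) / ((t : ℝ) : ℂ) = ((φ t : ℝ) : ℂ) := fun t => by
    rw [← Complex.ofReal_div, fockKernel_ofReal, hφ, Complex.ofReal_div]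
  have hφi : Integrable φ μ := by
    refine hint.norm.congr (Eventually.of_forall fun t => ?_)
    dsimp only
    rw [heq, Complex.norm_real, Real.norm_eq_abs, abs_of_nonneg (hφ0 t)]
  have hval : ‖hausdorff μ (fockKernel α a) (a : ℂ)‖ₑ = ∫⁻ t, ENNReal.ofReal (φ t) ∂μ := by
    rw [hausdorff, integral_congr_ae (Eventually.of_forall heq), integral_complex_ofReal,
      ← ofReal_norm, Complex.norm_real, Real.norm_eq_abs, abs_of_nonneg (integral_nonneg hφ0),
      ofReal_integral_eq_lintegral_ofReal hφi (Eventually.of_forall hφ0)]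
  rw [hval, ← lintegral_mul_const' _ _ (fockWeight_ne_top α _)]
  refine (setLIntegral_mono' (measurableSet_coe_le 1) fun t ht => ?_).trans
    (setLIntegral_le_lintegral {t : Set.Ioi (0 : ℝ) | (t : ℝ) ≤ 1} _)
  have ht0 : (0 : ℝ) < t := t.2
  have ht1 : (t : ℝ) ≤ 1 := ht
  rw [fockWeight, ← ENNReal.ofReal_mul (hφ0 t)]
  refine ENNReal.ofReal_le_ofReal ?_
  rw [hφ]
  dsimp only
  rw [div_mul_eq_mul_div, ← Real.exp_add]
  refine div_le_div_of_nonneg_right (Real.one_le_exp ?_) ht0.le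
  rw [Complex.norm_real, Real.norm_eq_abs, sq_abs]
  have h1 : a ^ 2 ≤ a * (a / (t : ℝ)) := by
    rw [← mul_div_assoc, ← sq, le_div_iff₀ ht0]
    nlinarith [sq_nonneg a]
  nlinarith [mul_le_mul_of_nonneg_left h1 hα.le]

/-- A compact operator sends a bounded sequence, up to a nonzero scalar and passage to a subsequence,
to a convergent sequence. The scalar shrinks the sequence into the neighbourhood of the origin whose
image is relatively compact. -/
theorem exists_subseq_tendsto_of_isCompactOperator {q : ℝ≥0∞} [Fact (0 < p)] [Fact (0 < q)]
    [Fact (0 < α)] {T : FockSpace p α →ₗ[ℂ] FockSpace q α} (hT : IsCompactOperator T)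
    {k : ℕ → FockSpace p α} {M : ℝ≥0∞} (hM : M ≠ ∞) (hk : ∀ n, fockENorm p α (k n) ≤ M) :
    ∃ c : ℂ, c ≠ 0 ∧ ∃ (F : FockSpace q α) (φ : ℕ → ℕ), StrictMono φ ∧
      Tendsto (fun n => c • T (k (φ n))) atTop (𝓝 F) := by
  obtain ⟨K, hK, hnhds⟩ := hT
  obtain ⟨ε, hε, hball⟩ := Metric.mem_nhds_iff.1 hnhds
  have hr := toReal_min_one_pos p
  set r := (min p 1).toReal with hrdef
  set c : ℝ := (ε / 2) ^ (1 / r) / (M.toReal + 1) with hc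
  have hM0 : 0 ≤ M.toReal := ENNReal.toReal_nonneg
  have hc0 : 0 < c := by positivity
  have hmem : ∀ n, (c : ℂ) • k n ∈ Metric.ball (0 : FockSpace p α) ε := fun n => by
    have h0 : ((c : ℂ) • k n).toFun - (0 : FockSpace p α).toFun = (c : ℂ) • (k n).toFun :=
      sub_zero _
    rw [Metric.mem_ball, FockSpace.dist_eq, h0, fockENorm_const_smul, ENNReal.toReal_mul,
      toReal_enorm, Complex.norm_real, Real.norm_eq_abs, abs_of_pos hc0, ← hrdef]
    have h1 : (fockENorm p α (k n).toFun).toReal ≤ M.toReal := ENNReal.toReal_mono hM (hk n)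
    have h2 : c * (fockENorm p α (k n).toFun).toReal ≤ (ε / 2) ^ (1 / r) := by
      rw [hc, div_mul_eq_mul_div, div_le_iff₀ (by positivity)]
      gcongr
      linarith
    have h3 := Real.rpow_le_rpow (by positivity) h2 hr.le
    rw [← Real.rpow_mul (by positivity), one_div_mul_cancel hr.ne', Real.rpow_one] at h3
    linarith
  obtain ⟨F, -, φ, hφ, hlim⟩ := hK.isSeqCompact fun n => hball (hmem n)
  refine ⟨c, by exact_mod_cast hc0.ne', F, φ, hφ, hlim.congr fun n => ?_⟩
  rw [Function.comp_apply, map_smul]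

/-- Along a subsequence, the images of the kernels at `n → ∞` converge in norm; they tend to `0`
pointwise, so the limit is `0`, while their weighted value at `n` stays above the mass of
`(0, 1]`. -/
theorem IsCompactHausdorff.hausdorffMass_restrict_eq_zero {q : ℝ≥0∞} [hp : Fact (0 < p)]
    [hq : Fact (0 < q)] [hα : Fact (0 < α)] (h : IsCompactHausdorff μ p q α) :
    hausdorffMass (μ.restrict {t : Set.Ioi (0 : ℝ) | (t : ℝ) ≤ 1}) = 0 := by
  obtain ⟨T, hT, hcomp⟩ := h
  have hα0 := hα.out
  obtain ⟨k, hk⟩ : ∃ k : ℕ → FockSpace p α, ∀ n, (k n).toFun = fockKernel α n :=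
    ⟨fun n => ⟨fockKernel α n, differentiable_fockKernel α n, by
      rw [fockENorm_fockKernel]; exact (fockENorm_one_ne_top hp.out hα0).lt_top⟩, fun n => rfl⟩
  have hTk : ∀ n z, T (k n) z = hausdorff μ (fockKernel α n) z := fun n z => by
    rw [(hT (k n) z).2, hk, hausdorff]
  obtain ⟨c, hc, F, φ, hφ, hlim⟩ := exists_subseq_tendsto_of_isCompactOperator (k := k) hcomp
    (fockENorm_one_ne_top hp.out hα0) fun n => by
      rw [hk, fockENorm_fockKernel]
  have hlim' := FockSpace.tendsto_fockENorm_of_tendsto hlim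
  simp only [FockSpace.toFun_smul] at hlim'
  obtain ⟨C, hC, heval⟩ := exists_enorm_mul_fockWeight_le hα0 q hq.out
  have hev : ∀ n z, ‖c * hausdorff μ (fockKernel α (φ n)) z - F z‖ₑ * fockWeight α z ≤
      C * fockENorm q α (c • (T (k (φ n))).toFun - F.toFun) := fun n z => by
    have h := heval (c • T (k (φ n)) - F).toFun (c • T (k (φ n)) - F).differentiable z
    rwa [FockSpace.toFun_sub, FockSpace.toFun_smul, Pi.sub_apply, Pi.smul_apply, smul_eq_mul,
      hTk] at h
  have hup : Tendsto (fun n => C * fockENorm q α (c • (T (k (φ n))).toFun - F.toFun)) atTop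
      (𝓝 0) := by
    have h := ENNReal.Tendsto.const_mul hlim' (Or.inr hC)
    rwa [mul_zero] at h
  -- The norm limit is also the pointwise limit, which vanishes.
  have hF : ∀ z, F z = 0 := by
    intro z
    have h1 : Tendsto (fun n => c * hausdorff μ (fockKernel α (φ n)) z) atTop (𝓝 0) := by
      rw [← mul_zero c]
      refine Tendsto.const_mul c (squeeze_zero_norm (fun n => norm_hausdorff_fockKernel_le hα0 z
        (integrable_exp_of_integrable hα0 (fun f z => (hT f z).1) ‖z‖) _) ?_)
      have h0 : Tendsto (fun n => Real.exp (-(α / 4) * (φ n : ℝ) ^ 2)) atTop (𝓝 0) :=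
        Real.tendsto_exp_atBot.comp (Tendsto.const_mul_atTop_of_neg (by linarith)
          ((tendsto_pow_atTop two_ne_zero).comp
            (tendsto_natCast_atTop_atTop.comp hφ.tendsto_atTop)))
      simpa only [zero_mul] using h0.mul_const _
    have h2 : Tendsto (fun n => ‖c * hausdorff μ (fockKernel α (φ n)) z - F z‖ₑ * fockWeight α z)
        atTop (𝓝 (‖0 - F z‖ₑ * fockWeight α z)) :=
      ENNReal.Tendsto.mul_const (h1.sub_const (F z)).enorm (Or.inr (fockWeight_ne_top α z))
    have h3 := le_of_tendsto_of_tendsto' h2 hup fun n => hev n z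
    rw [nonpos_iff_eq_zero, mul_eq_zero, or_iff_left (fockWeight_ne_zero α z), enorm_eq_zero,
      zero_sub, neg_eq_zero] at h3
    exact h3
  have hle : ‖c‖ₑ * hausdorffMass (μ.restrict {t : Set.Ioi (0 : ℝ) | (t : ℝ) ≤ 1}) ≤ 0 := by
    refine ge_of_tendsto' hup fun n => le_trans ?_ (hev n (φ n : ℂ))
    rw [hF, sub_zero, enorm_mul, mul_assoc]
    refine mul_le_mul_right ?_ _
    have hint := (hT (k (φ n)) ((φ n : ℝ) : ℂ)).1
    rw [hk] at hint
    simpa only [Complex.ofReal_natCast] using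
      hausdorffMass_restrict_le_enorm_hausdorff_fockKernel hα0 (φ n : ℝ) hint
  rw [nonpos_iff_eq_zero, mul_eq_zero, or_iff_right (by simpa using hc)] at hle
  exact hle

theorem measure_eq_zero_of_hausdorffMass_restrict_eq_zero {s : Set (Set.Ioi (0 : ℝ))}
    (h : hausdorffMass (μ.restrict s) = 0) : μ s = 0 := by
  rw [hausdorffMass, lintegral_eq_zero_iff (by fun_prop)] at h
  rw [← Measure.restrict_eq_zero, ← ae_eq_bot, ← Filter.eventually_false_iff_eq_bot]
  filter_upwards [h] with t ht
  have ht0 : (0 : ℝ) < t := t.2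
  exact (ENNReal.ofReal_pos.2 (one_div_pos.2 ht0)).ne' ht

end Necessity

theorem theorem6p5 (α : ℝ) [Fact (0 < α)] (μ : Measure (Set.Ioi (0 : ℝ)))
    (hμ : ∫⁻ t : Set.Ioi (0 : ℝ), ENNReal.ofReal (1 / (t : ℝ)) ∂μ = 1) :
    List.TFAE [
      ∃ (p q : ℝ≥0∞) (_ : Fact (0 < p)) (_ : Fact (0 < q)), IsCompactHausdorff μ p q α,
      μ {t : Set.Ioi (0 : ℝ) | (t : ℝ) ≤ 1} = 0,
      ∀ (p : ℝ≥0∞) [Fact (0 < p)], IsCompactHausdorff μ p p α] := by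
  tfae_have 1 → 2 := by
    rintro ⟨p, q, _, _, h⟩
    exact measure_eq_zero_of_hausdorffMass_restrict_eq_zero h.hausdorffMass_restrict_eq_zero
  tfae_have 2 → 3 := by
    intro h p _
    have hm : hausdorffMass μ ≠ ∞ := by rw [hausdorffMass, hμ]; exact ENNReal.one_ne_top
    refine isCompactHausdorff_of_ae_one_lt p α ?_ hm
    rw [ae_iff]
    simpa only [not_lt] using h
  tfae_have 3 → 1 := fun h => ⟨1, 1, ⟨one_pos⟩, ⟨one_pos⟩, @h 1 ⟨one_pos⟩⟩
  tfae_finish
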